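/- Let $\mathcal G$ be a three-dimensional nilpotent Lie group, $\pi:P\to M$ a smooth principal $\mathcal G$-bundle (right action) over a one-dimensional manifold $M$, and $J\subseteq\mathbb R$ a nondegenerate interval. Let $(\bar g(t),\bar H(t))_{t\in J}$ be a smooth family of $\mathcal G$-invariant Riemannian metrics and $\mathcal G$-invariant closed three-forms on $P$. **Notation.** Let $\mathfrak G=P\times_{\mathrm{Ad}}\mathfrak g$ be the adjoint bundle and $\mathcal E=\mathfrak G\oplus TM$. Let $\bar A(t)$ be the principal connection whose horizontal space is the $\bar g(t)$-orthogonal complement of the vertical space. Through $Z\mapsto\{p,\bar A Z\}+\pi_*Z$ invariant tensors on $P$ correspond to sections of tensor bundles of $\mathcal E$; $\bar g(t)$ corresponds to $G(t)\oplus g(t)$, with $G$ a fibre metric on $\mathfrak G$ and $g$ a metric on $M$, $\bar H(t)$ to $H(t)\in\Gamma(\Lambda^3\mathcal E^*)$, and $\partial_t\bar A$ to $\partial_tA\in\Gamma(T^*M\otimes\mathfrak G)$. The Lie bracket of invariant vector fields on $P$ gives a bracket $[\,,]$ on $\Gamma(\mathcal E)$; on the fibres of $\mathfrak G$ it is $[\{p,x\},\{p,y\}]=-\{p,[x,y]_{\mathfrak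 g}\}$, and $D_v\eta=[v,\eta]$ ($v\in TM$, $\eta\in\mathfrak G$) is the connection on $\mathfrak G$ induced by $\bar A$, extended to $\mathcal E$ by the Levi-Civita connection of $g$. $\Delta$ is the Laplace-Beltrami operator of $g(t)$ on functions. Repeated dots $\cdot,\cdot_i$ are traced with $G$ or $g$ (in $H^2$ with $G\oplus g$), stars denote free arguments, norms are full tensor norms, $H^2(X,Y)=\langle i_XH,i_YH\rangle=\sum_{a,b}H(X,e_a,e_b)H(Y,e_a,e_b)$ in an orthonormal frame of $\mathcal E$, $(\alpha\wedge\beta)(X,Y)=\alpha(X)\beta(Y)-\alpha(Y)\beta(X)$, $\pi_{\mathfrak G},\pi_{TM}$ are the projections of $\mathcal E$, and $H^{\mathfrak G}=H(\pi_{\mathfrak G}*,\pi_{\mathfrak G}*,\pi_{\mathfrak G}*)$. **Flow.** Suppose that $(\bar g(t),\bar H(t))$ solves the generalized Ricci flow equations in the canonical gauge, which over a one-dimensional base read $$\begin{aligned} \tfrac{\partial G}{\partial t}(\eta_1,\eta_2)={}&(D_\cdot DG)_\cdot(\eta_1,\eta_2)-D_{\cdot_2}G(\eta_1,\cdot_1)D_{\cdot_2}G(\cdot_1,\eta_2)+\mathrm{tr}_G\,G([\cdot,\eta_1],[\cdot,\eta_2])\\&-\tfrac12\mathrm{tr}_G\,G([\cdot_1,\cdot_2],\eta_1)G([\cdot_1,\cdot_2],\eta_2)+\tfrac12H^2(\eta_1,\eta_2),\\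 G\bigl(\tfrac{\partial A}{\partial t}v,\eta\bigr)={}&\mathrm{tr}_G\,D_vG([\cdot,\eta],\cdot)+\tfrac12H^2(v,\eta),\\ \tfrac{\partial g}{\partial t}(v_1,v_2)={}&\tfrac12D_{v_1}G(\cdot_1,\cdot_2)D_{v_2}G(\cdot_1,\cdot_2)+\tfrac12H^2(v_1,v_2),\\ \tfrac{\partial\bar H}{\partial t}={}&dB, \end{aligned}$$ where $B$, viewed as an invariant two-form on $P$, is $$B=D_\cdot H(\cdot,*,*)-D_{\cdot_1}G(\cdot_2,\pi_{\mathfrak G}*)\wedge H(\cdot_1,\cdot_2,*)+\tfrac12\mathrm{tr}_G\,G([\cdot_1,\cdot_2],\pi_{\mathfrak G}*)\wedge H(\cdot_1,\cdot_2,*).$$ **Claim.** Let $|[,]|^2$ be the square norm, with respect to $G(t)$, of the bracket $\mathfrak G\otimes\mathfrak G\to\mathfrak G$. For every $t\in J$ it is a smooth function on $M$, and on $J\times M$ (with one-sided time derivatives at endpoints of $J$ that belong to $J$) $$\frac{\partial}{\partial t}|[,]|^2=\Delta|[,]|^2-\frac32|[,]|^4-S_A,$$ where $$S_A=|T|^2+|H(\pi_{TM}*,\cdot_1,\cdot_2)[\cdot_1,\cdot_2]|^2+\tfrac16|H^{\mathfrak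 G}|^2\,|[,]|^2\ \ge\ 0$$ and $$T=DG(\cdot,*_1)G([*_2,*_3],\cdot)-DG(*_2,\cdot)G([\cdot,*_3],*_1)+DG(*_3,\cdot)G([\cdot,*_2],*_1).$$ -/

import Mathlib

open scoped Manifold ContDiff

/-! ### Calculus on manifolds -/

section Calculus

variable {E : Type*} [NormedAddCommGroup E] [NormedSpace ℝ E]
  {X : Type*} [TopologicalSpace X] [ChartedSpace E X]

/-- The derivative `v[f]` of a real function `f` on a manifold along a tangent vector `v`. -/
noncomputable def dirDeriv (f : X → ℝ) (x : X) (v : TangentSpace 𝓘(ℝ, E) x) : ℝ :=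
  NormedSpace.fromTangentSpace (𝕜 := ℝ) (f x) (mfderiv 𝓘(ℝ, E) 𝓘(ℝ, ℝ) f x v)

/-- A vector field is smooth. -/
def SmoothField (Y : ∀ x : X, TangentSpace 𝓘(ℝ, E) x) [IsManifold 𝓘(ℝ, E) 1 X] : Prop :=
  ContMDiff 𝓘(ℝ, E) (𝓘(ℝ, E)).tangent ∞ (fun x => (⟨x, Y x⟩ : TangentBundle 𝓘(ℝ, E) X))

/-- The exterior derivative of an `(n + 1)`-form, evaluated on `n + 2` vector fields by the usual
formula
`dσ(Y₀, …) = ∑ᵢ (-1)ⁱ Yᵢ[σ(…, Ŷᵢ, …)] + ∑_{i < j} (-1)^{i + j} σ([Yᵢ, Yⱼ], …, Ŷᵢ, …, Ŷⱼ, …)`.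
In the double sum below the pair `(i, j)` with `i ≤ j` stands for the pair `i < j + 1`, which
explains the minus sign. -/
noncomputable def extDerivOnFields {n : ℕ} (σ : ∀ x : X, (Fin (n + 1) → TangentSpace 𝓘(ℝ, E) x) → ℝ)
    (Y : Fin (n + 2) → ∀ x : X, TangentSpace 𝓘(ℝ, E) x) (x : X) : ℝ :=
  (∑ i : Fin (n + 2), (-1) ^ (i : ℕ) *
      dirDeriv (fun y => σ y (i.removeNth (fun k => Y k y))) x (Y i x)) -
    ∑ i : Fin (n + 1), ∑ j ∈ Finset.Ici i, (-1) ^ (i + j : ℕ) *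
      σ x (Matrix.vecCons (VectorField.mlieBracket 𝓘(ℝ, E) (Y i.castSucc) (Y j.succ) x)
        (j.removeNth (i.castSucc.removeNth (fun k => Y k x))))

end Calculus

/-- The coordinate vector field `∂/∂x` of the preferred chart at `m₀` of a one-dimensional manifold,
that is, the pullback of the unit vector field of `ℝ` under that chart. -/
noncomputable def coordField {M : Type*} [TopologicalSpace M] [ChartedSpace ℝ M] (m₀ m : M) :
    TangentSpace 𝓘(ℝ, ℝ) m :=
  VectorField.mpullback 𝓘(ℝ, ℝ) 𝓘(ℝ, ℝ) (chartAt ℝ m₀) (fun _ => (1 : ℝ)) m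

/-! ### Three-dimensional Lie groups and principal bundles over one-dimensional manifolds -/

/-- A three-dimensional Lie group is nilpotent if its Lie algebra is. -/
def IsNilpotentLieGroup (𝒢 : Type*) [TopologicalSpace 𝒢]
    [ChartedSpace (EuclideanSpace ℝ (Fin 3)) 𝒢] [Group 𝒢] [LieGroup (𝓡 3) ∞ 𝒢] : Prop :=
  haveI : LieGroup (𝓡 3) (minSmoothness ℝ 3) 𝒢 :=
    LieGroup.of_le (I := 𝓡 3) (n := ∞) (by
      rw [minSmoothness_of_isRCLikeNormedField]
      exact ENat.LEInfty.out)
  LieRing.IsNilpotent (GroupLieAlgebra (𝓡 3) 𝒢)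

/-- A smooth principal `𝒢`-bundle `proj : P → M` with three-dimensional structure group acting
from the right and with one-dimensional base. Local triviality is expressed by smooth local sections
`s : U → P` for which `(u, a) ↦ s(u) a` is a diffeomorphism from `U × 𝒢` onto `proj⁻¹(U)`, with
inverse `q ↦ (proj q, φ q)`. -/
structure PrincipalBundle (𝒢 P M : Type*)
    [TopologicalSpace 𝒢] [ChartedSpace (EuclideanSpace ℝ (Fin 3)) 𝒢] [Group 𝒢]
    [TopologicalSpace P] [ChartedSpace (EuclideanSpace ℝ (Fin 4)) P]
    [TopologicalSpace M] [ChartedSpace ℝ M] where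
  proj : P → M
  act : P → 𝒢 → P
  act_one : ∀ p, act p 1 = p
  act_mul : ∀ p a b, act p (a * b) = act (act p a) b
  proj_act : ∀ p a, proj (act p a) = proj p
  smooth_proj : ContMDiff (𝓡 4) 𝓘(ℝ, ℝ) ∞ proj
  smooth_act : ContMDiff ((𝓡 4).prod (𝓡 3)) (𝓡 4) ∞ (fun z : P × 𝒢 => act z.1 z.2)
  locally_trivial : ∀ m : M, ∃ U : Set M, IsOpen U ∧ m ∈ U ∧ ∃ s : M → P, ∃ φ : P → 𝒢,
    ContMDiffOn 𝓘(ℝ, ℝ) (𝓡 4) ∞ s U ∧ ContMDiffOn (𝓡 4) (𝓡 3) ∞ φ (proj ⁻¹' U) ∧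
    (∀ u ∈ U, proj (s u) = u) ∧ (∀ u ∈ U, ∀ a, φ (act (s u) a) = a) ∧
    (∀ q ∈ proj ⁻¹' U, act (s (proj q)) (φ q) = q)

section Flow

variable {𝒢 P M : Type*}
  [TopologicalSpace 𝒢] [ChartedSpace (EuclideanSpace ℝ (Fin 3)) 𝒢] [Group 𝒢]
  [TopologicalSpace P] [ChartedSpace (EuclideanSpace ℝ (Fin 4)) P]
  [TopologicalSpace M] [ChartedSpace ℝ M]

namespace PrincipalBundle

theorem proj_surjective (B : PrincipalBundle 𝒢 P M) : Function.Surjective B.proj := by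
  intro m
  obtain ⟨U, -, hm, s, -, -, -, hs, -⟩ := B.locally_trivial m
  exact ⟨s m, hs m hm⟩

/-- A point of `P` over `m`. It is used only in invariant expressions, which do not depend on it. -/
noncomputable def pt (B : PrincipalBundle 𝒢 P M) (m : M) : P :=
  Function.surjInv B.proj_surjective m

/-- The derivative of the right translation by `a` at `p`. -/
noncomputable def dRight (B : PrincipalBundle 𝒢 P M) (a : 𝒢) (p : P) (Z : TangentSpace (𝓡 4) p) :
    TangentSpace (𝓡 4) (B.act p a) :=
  mfderiv (𝓡 4) (𝓡 4) (fun q => B.act q a) p Z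

/-- The derivative of the projection. -/
noncomputable def dProj (B : PrincipalBundle 𝒢 P M) (p : P) (Z : TangentSpace (𝓡 4) p) :
    TangentSpace 𝓘(ℝ, ℝ) (B.proj p) :=
  mfderiv (𝓡 4) 𝓘(ℝ, ℝ) B.proj p Z

/-- The value at `p` of the fundamental vector field of `x ∈ 𝔤`, the velocity at `a = 1` of
`a ↦ p a` in the direction `x`. The map `x ↦ fund p x` is an isomorphism of `𝔤` onto the vertical
space at `p`; under the identification of the fibre of the adjoint bundle `𝔊 = P ×_Ad 𝔤` over
`proj p` with the vertical space at `p`, the vector `fund p x` is the class `{p, x}`. -/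
noncomputable def fund (B : PrincipalBundle 𝒢 P M) (p : P) (x : GroupLieAlgebra (𝓡 3) 𝒢) :
    TangentSpace (𝓡 4) p :=
  (mfderiv (𝓡 3) (𝓡 4) (fun a : 𝒢 => B.act p a) 1 x : EuclideanSpace ℝ (Fin 4))

end PrincipalBundle

/-- A smooth family, over the time interval `J`, of invariant Riemannian metrics and invariant
closed three-forms on the total space of a principal bundle. -/
structure InvariantFamily [IsManifold (𝓡 4) ∞ P] (B : PrincipalBundle 𝒢 P M) (J : Set ℝ) where
  metric : ℝ → Bundle.ContMDiffRiemannianMetric (𝓡 4) ∞ (EuclideanSpace ℝ (Fin 4))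
    (fun p : P => TangentSpace (𝓡 4) p)
  form : ℝ → ∀ p : P, (TangentSpace (𝓡 4) p) [⋀^Fin 3]→L[ℝ] ℝ
  metric_smooth : ContMDiffOn ((𝓘(ℝ, ℝ)).prod (𝓡 4))
    ((𝓡 4).prod 𝓘(ℝ, EuclideanSpace ℝ (Fin 4) →L[ℝ] EuclideanSpace ℝ (Fin 4) →L[ℝ] ℝ)) ∞
    (fun z : ℝ × P => Bundle.TotalSpace.mk'
      (EuclideanSpace ℝ (Fin 4) →L[ℝ] EuclideanSpace ℝ (Fin 4) →L[ℝ] ℝ)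
      (E := fun p : P => TangentSpace (𝓡 4) p →L[ℝ] TangentSpace (𝓡 4) p →L[ℝ] ℝ)
      z.2 ((metric z.1).inner z.2))
    (J ×ˢ Set.univ)
  form_smooth : ∀ Y : Fin 3 → ∀ p : P, TangentSpace (𝓡 4) p, (∀ i, SmoothField (Y i)) →
    ContMDiffOn ((𝓘(ℝ, ℝ)).prod (𝓡 4)) 𝓘(ℝ, ℝ) ∞
      (fun z : ℝ × P => form z.1 z.2 (fun i => Y i z.2)) (J ×ˢ Set.univ)
  metric_invariant : ∀ t ∈ J, ∀ (a : 𝒢) (p : P) (Z W : TangentSpace (𝓡 4) p),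
    (metric t).inner (B.act p a) (B.dRight a p Z) (B.dRight a p W) = (metric t).inner p Z W
  form_invariant : ∀ t ∈ J, ∀ (a : 𝒢) (p : P) (Z : Fin 3 → TangentSpace (𝓡 4) p),
    form t (B.act p a) (fun i => B.dRight a p (Z i)) = form t p Z
  form_closed : ∀ t ∈ J, ∀ Y : Fin 4 → ∀ p : P, TangentSpace (𝓡 4) p, (∀ i, SmoothField (Y i)) →
    ∀ p : P, extDerivOnFields (fun q => form t q) Y p = 0

/-- The standard basis of the Lie algebra `𝔤`. -/
noncomputable def lieBasis (𝒢 : Type*) [TopologicalSpace 𝒢]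
    [ChartedSpace (EuclideanSpace ℝ (Fin 3)) 𝒢] [Group 𝒢] (i : Fin 3) :
    GroupLieAlgebra (𝓡 3) 𝒢 :=
  (EuclideanSpace.single i (1 : ℝ) : EuclideanSpace ℝ (Fin 3))

/-- The standard basis of a tangent space of `P`. -/
noncomputable def tangentBasis {P : Type*} [TopologicalSpace P]
    [ChartedSpace (EuclideanSpace ℝ (Fin 4)) P] (p : P) (i : Fin 4) : TangentSpace (𝓡 4) p :=
  (EuclideanSpace.single i (1 : ℝ) : EuclideanSpace ℝ (Fin 4))

/-- The bracket of the fibres of the adjoint bundle, as a bracket on `𝔤` through `x ↦ {p, x}`.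
It is induced by the Lie bracket of invariant vertical vector fields on `P` (which correspond to
right-invariant fields on the fibres), so that `[{p, x}, {p, y}] = -{p, [x, y]}`, with the Lie
bracket of `𝔤` (left-invariant fields) on the right. -/
noncomputable def adBracket (x y : GroupLieAlgebra (𝓡 3) 𝒢) : GroupLieAlgebra (𝓡 3) 𝒢 := -⁅x, y⁆

/-! Sections of tensor bundles built from `𝔊` and `TM` are treated as the equivariant functions on
`P` that they are: a tensor over `m = proj p` is written at `p` in terms of `x, y, … ∈ 𝔤`, which
stand for `{p, x}, {p, y}, …`, and of tangent vectors `v` of `M` at `m`. -/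

namespace InvariantFamily

variable [IsManifold (𝓡 4) ∞ P] {B : PrincipalBundle 𝒢 P M} {J : Set ℝ}

/-- The fibre metric `G(t)` on `𝔊`: `G({p, x}, {p, y})`. -/
noncomputable def G (F : InvariantFamily B J) (t : ℝ) (p : P) (x y : GroupLieAlgebra (𝓡 3) 𝒢) : ℝ :=
  (F.metric t).inner p (B.fund p x) (B.fund p y)

/-- The inverse matrix `G^{ij}` in the standard basis of `𝔤`. -/
noncomputable def Ginv (F : InvariantFamily B J) (t : ℝ) (p : P) : Matrix (Fin 3) (Fin 3) ℝ :=
  (Matrix.of fun i j => F.G t p (lieBasis 𝒢 i) (lieBasis 𝒢 j))⁻¹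

/-- The trace `tr_G S = G^{ij} S(eᵢ, eⱼ)` of a bilinear form `S` on a fibre of `𝔊`. -/
noncomputable def trG (F : InvariantFamily B J) (t : ℝ) (p : P)
    (S : GroupLieAlgebra (𝓡 3) 𝒢 → GroupLieAlgebra (𝓡 3) 𝒢 → ℝ) : ℝ :=
  ∑ i, ∑ j, F.Ginv t p i j * S (lieBasis 𝒢 i) (lieBasis 𝒢 j)

/-- The principal connection `Ā(t) : TP → 𝔤` of the invariant metric: `fund p (Ā Z)` is the
orthogonal projection of `Z` onto the vertical space. -/
noncomputable def conn (F : InvariantFamily B J) (t : ℝ) (p : P) (Z : TangentSpace (𝓡 4) p) :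
    GroupLieAlgebra (𝓡 3) 𝒢 :=
  ∑ i, ∑ j, (F.Ginv t p i j * (F.metric t).inner p Z (B.fund p (lieBasis 𝒢 i))) • lieBasis 𝒢 j

/-- The horizontal lift to `p` of a tangent vector of the base: the unique vector that projects
to `v` and is orthogonal to the vertical space. -/
noncomputable def hor (F : InvariantFamily B J) (t : ℝ) (p : P)
    (v : TangentSpace 𝓘(ℝ, ℝ) (B.proj p)) : TangentSpace (𝓡 4) p :=
  Classical.epsilon fun Z : TangentSpace (𝓡 4) p =>
    B.dProj p Z = v ∧ ∀ x, (F.metric t).inner p Z (B.fund p x) = 0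

/-- The metric `g(t)` on the base. -/
noncomputable def g (F : InvariantFamily B J) (t : ℝ) (m : M) (v w : TangentSpace 𝓘(ℝ, ℝ) m) : ℝ :=
  (F.metric t).inner (B.pt m) (F.hor t (B.pt m) (v : ℝ)) (F.hor t (B.pt m) (w : ℝ))

/-- The trace `tr_g S` of a bilinear form on the line `T_m M`. -/
noncomputable def trg (F : InvariantFamily B J) (t : ℝ) (m : M)
    (S : TangentSpace 𝓘(ℝ, ℝ) m → TangentSpace 𝓘(ℝ, ℝ) m → ℝ) : ℝ :=
  S (coordField m m) (coordField m m) / F.g t m (coordField m m) (coordField m m)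

/-- The Christoffel symbol at `m`, in the preferred chart at `m`, of the Levi-Civita connection of
`g(t)`: with `X = ∂/∂x`, `∇_X X = Γ X` where `Γ = X[g(X, X)] / (2 g(X, X))`. -/
noncomputable def christoffel (F : InvariantFamily B J) (t : ℝ) (m : M) : ℝ :=
  dirDeriv (fun m' => F.g t m' (coordField m m') (coordField m m')) m (coordField m m) /
    (2 * F.g t m (coordField m m) (coordField m m))

/-- The Laplace-Beltrami operator `Δ f = tr_g ∇∇f` of `g(t)`, that is
`(X[X[f]] - (∇_X X)[f]) / g(X, X)` with `X = ∂/∂x`. -/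
noncomputable def laplacian (F : InvariantFamily B J) (t : ℝ) (f : M → ℝ) (m : M) : ℝ :=
  (dirDeriv (fun m' => dirDeriv f m' (coordField m m')) m (coordField m m) -
      F.christoffel t m * dirDeriv f m (coordField m m)) /
    F.g t m (coordField m m) (coordField m m)

/-- `D_v G(x, y)`, for the connection `D` on `𝔊` induced by `Ā`: equivariant functions are
differentiated along horizontal lifts. (On sections of `𝔊`, viewed as invariant vertical fields,
this `D_v η` is the bracket of the horizontal lift of `v` with `η`.) -/
noncomputable def DG (F : InvariantFamily B J) (t : ℝ) (p : P) (v : TangentSpace 𝓘(ℝ, ℝ) (B.proj p))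
    (x y : GroupLieAlgebra (𝓡 3) 𝒢) : ℝ :=
  dirDeriv (fun q => F.G t q x y) p (F.hor t p v)

/-- `(D_· DG)_·(x, y)`, the `g`-trace of the second covariant derivative of `G`, where `D` also
denotes the sum of `D` and the Levi-Civita connection: `(D_X(DG(X)) - DG(∇_X X)) / g(X, X)`. -/
noncomputable def trDDG (F : InvariantFamily B J) (t : ℝ) (p : P)
    (x y : GroupLieAlgebra (𝓡 3) 𝒢) : ℝ :=
  (dirDeriv (fun q => F.DG t q (coordField (B.proj p) (B.proj q)) x y) p
        (F.hor t p (coordField (B.proj p) (B.proj p))) -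
      F.christoffel t (B.proj p) * F.DG t p (coordField (B.proj p) (B.proj p)) x y) /
    F.g t (B.proj p) (coordField (B.proj p) (B.proj p)) (coordField (B.proj p) (B.proj p))

/-- `H(v, x, y)` with `v` tangent to the base and `x, y` in `𝔊`. -/
noncomputable def Hmix (F : InvariantFamily B J) (t : ℝ) (p : P)
    (v : TangentSpace 𝓘(ℝ, ℝ) (B.proj p)) (x y : GroupLieAlgebra (𝓡 3) 𝒢) : ℝ :=
  F.form t p ![F.hor t p v, B.fund p x, B.fund p y]

/-- `H(x, y, z)` with `x, y, z` in `𝔊`. -/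
noncomputable def Hvert (F : InvariantFamily B J) (t : ℝ) (p : P)
    (x y z : GroupLieAlgebra (𝓡 3) 𝒢) : ℝ :=
  F.form t p ![B.fund p x, B.fund p y, B.fund p z]

/-- `D_· H(·, x, y)`, the `g`-trace of the covariant derivative of `H`. -/
noncomputable def trDH (F : InvariantFamily B J) (t : ℝ) (p : P)
    (x y : GroupLieAlgebra (𝓡 3) 𝒢) : ℝ :=
  (dirDeriv (fun q => F.Hmix t q (coordField (B.proj p) (B.proj q)) x y) p
        (F.hor t p (coordField (B.proj p) (B.proj p))) -
      F.christoffel t (B.proj p) * F.Hmix t p (coordField (B.proj p) (B.proj p)) x y) /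
    F.g t (B.proj p) (coordField (B.proj p) (B.proj p)) (coordField (B.proj p) (B.proj p))

/-- `H²(Z, W) = ⟨i_Z H, i_W H⟩`, both remaining slots being contracted with the total metric. -/
noncomputable def Hsq (F : InvariantFamily B J) (t : ℝ) (p : P) (Z W : TangentSpace (𝓡 4) p) : ℝ :=
  let γ : Matrix (Fin 4) (Fin 4) ℝ :=
    (Matrix.of fun i j => (F.metric t).inner p (tangentBasis p i) (tangentBasis p j))⁻¹
  ∑ i, ∑ j, ∑ k, ∑ l, γ i j * γ k l *
    (F.form t p ![Z, tangentBasis p i, tangentBasis p k] *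
      F.form t p ![W, tangentBasis p j, tangentBasis p l])

/-- The two-form
`B = D_·H(·, *, *) - D_{·₁}G(·₂, π_𝔊 *) ∧ H(·₁, ·₂, *) + ½ tr_G G([·₁, ·₂], π_𝔊 *) ∧ H(·₁, ·₂, *)`
as an invariant two-form on `P`, with `(α ∧ β)(Z, W) = α(Z) β(W) - α(W) β(Z)`. -/
noncomputable def flowForm (F : InvariantFamily B J) (t : ℝ) (p : P)
    (Z : Fin 2 → TangentSpace (𝓡 4) p) : ℝ :=
  let z := F.conn t p (Z 0)
  let w := F.conn t p (Z 1)
  F.trDH t p z w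
    - F.trg t (B.proj p) (fun v v' => F.trG t p fun a a' =>
        F.DG t p v a z * F.form t p ![F.hor t p v', B.fund p a', Z 1] -
          F.DG t p v a w * F.form t p ![F.hor t p v', B.fund p a', Z 0])
    + (1 / 2) * F.trG t p (fun a a' => F.trG t p fun b b' =>
        F.G t p (adBracket a b) z * F.form t p ![B.fund p a', B.fund p b', Z 1] -
          F.G t p (adBracket a b) w * F.form t p ![B.fund p a', B.fund p b', Z 0])

/-- The generalized Ricci flow equations in the canonical gauge, in terms of the data
`(G, A, g, H)` and over a one-dimensional base (where the curvature of every principal connection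
and the Ricci tensor of `g` vanish). All time derivatives are taken within the time interval. -/
structure SolvesFlow (F : InvariantFamily B J) : Prop where
  /-- The equation for `∂G/∂t`. -/
  eq_G : ∀ t ∈ J, ∀ (p : P) (x y : GroupLieAlgebra (𝓡 3) 𝒢),
    HasDerivWithinAt (fun s => F.G s p x y)
      (F.trDDG t p x y
        - F.trg t (B.proj p) (fun v v' => F.trG t p fun a a' => F.DG t p v x a * F.DG t p v' a' y)
        + F.trG t p (fun a a' => F.G t p (adBracket a x) (adBracket a' y))
        - (1 / 2) * F.trG t p (fun a a' => F.trG t p fun b b' =>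
            F.G t p (adBracket a b) x * F.G t p (adBracket a' b') y)
        + (1 / 2) * F.Hsq t p (B.fund p x) (B.fund p y)) J t
  /-- The equation for `G(∂A/∂t v, y)`, where `∂A/∂t v` is `∂Ā/∂t` on any lift `Z` of `v`. -/
  eq_A : ∀ t ∈ J, ∀ (p : P) (Z : TangentSpace (𝓡 4) p) (y : GroupLieAlgebra (𝓡 3) 𝒢),
    HasDerivWithinAt (fun s => F.G t p (F.conn s p Z) y)
      (F.trG t p (fun a a' => F.DG t p (B.dProj p Z) (adBracket a y) a')
        + (1 / 2) * F.Hsq t p (F.hor t p (B.dProj p Z)) (B.fund p y)) J t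
  /-- The equation for `∂g/∂t`. -/
  eq_g : ∀ t ∈ J, ∀ (p : P) (v w : TangentSpace 𝓘(ℝ, ℝ) (B.proj p)),
    HasDerivWithinAt (fun s => F.g s (B.proj p) v w)
      ((1 / 2) * F.trG t p (fun a a' => F.trG t p fun b b' => F.DG t p v a b * F.DG t p w a' b')
        + (1 / 2) * F.Hsq t p (F.hor t p v) (F.hor t p w)) J t
  /-- The equation `∂H̄/∂t = dB`. -/
  eq_H : ∀ t ∈ J, ∀ Y : Fin 3 → ∀ p : P, TangentSpace (𝓡 4) p, (∀ i, SmoothField (Y i)) →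
    ∀ p : P, HasDerivWithinAt (fun s => F.form s p (fun i => Y i p))
      (extDerivOnFields (F.flowForm t) Y p) J t

/-- The square norm `|[,]|²` of the bracket of `𝔊`, as a function on the base. -/
noncomputable def bracketNormSq (F : InvariantFamily B J) (t : ℝ) (m : M) : ℝ :=
  F.trG t (B.pt m) fun a a' => F.trG t (B.pt m) fun b b' =>
    F.G t (B.pt m) (adBracket a b) (adBracket a' b')

/-- The tensor
`T = DG(·, *₁) G([*₂, *₃], ·) - DG(*₂, ·) G([·, *₃], *₁) + DG(*₃, ·) G([·, *₂], *₁)`. -/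
noncomputable def T (F : InvariantFamily B J) (t : ℝ) (p : P) (v : TangentSpace 𝓘(ℝ, ℝ) (B.proj p))
    (x y z : GroupLieAlgebra (𝓡 3) 𝒢) : ℝ :=
  F.trG t p (fun c c' => F.DG t p v c x * F.G t p (adBracket y z) c')
    - F.trG t p (fun c c' => F.DG t p v y c * F.G t p (adBracket c' z) x)
    + F.trG t p (fun c c' => F.DG t p v z c * F.G t p (adBracket c' y) x)

/-- `|T|²` at `p`. -/
noncomputable def TNormSq (F : InvariantFamily B J) (t : ℝ) (p : P) : ℝ :=
  F.trg t (B.proj p) fun v v' => F.trG t p fun a a' => F.trG t p fun b b' => F.trG t p fun c c' =>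
    F.T t p v a b c * F.T t p v' a' b' c'

/-- `|H(π_{TM} *, ·₁, ·₂) [·₁, ·₂]|²` at `p`, the square norm of a section of `T*M ⊗ 𝔊`. -/
noncomputable def HbracketNormSq (F : InvariantFamily B J) (t : ℝ) (p : P) : ℝ :=
  F.trg t (B.proj p) fun v v' =>
    F.trG t p fun a a' => F.trG t p fun b b' => F.trG t p fun c c' => F.trG t p fun d d' =>
      F.Hmix t p v a b * F.Hmix t p v' c d * F.G t p (adBracket a' b') (adBracket c' d')

/-- `|H^𝔊|²` at `p`. -/
noncomputable def HvertNormSq (F : InvariantFamily B J) (t : ℝ) (p : P) : ℝ :=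
  F.trG t p fun a a' => F.trG t p fun b b' => F.trG t p fun c c' =>
    F.Hvert t p a b c * F.Hvert t p a' b' c'

/-- `S_A = |T|² + |H(π_{TM} *, ·₁, ·₂) [·₁, ·₂]|² + (1/6) |H^𝔊|² |[,]|²`, as a function on the
base. -/
noncomputable def SA (F : InvariantFamily B J) (t : ℝ) (m : M) : ℝ :=
  F.TNormSq t (B.pt m) + F.HbracketNormSq t (B.pt m)
    + (1 / 6) * F.HvertNormSq t (B.pt m) * F.bracketNormSq t m

end InvariantFamily

end Flow

/-! Fix a time `t` and a point `p` of `P`. A three-dimensional nilpotent Lie algebra has a nonzero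
central vector, so a `G(t)`-orthonormal basis `b` can be chosen with `b 2` central; since every `ad
x` is nilpotent, hence traceless, the bracket reduces to `[b 0, b 1] = c • b 2`
(`exists_adapted_basis`).

Now keep this basis fixed while time and the point of `P` vary. It stops being orthonormal, but its
bracket relations live in the constant Lie algebra `𝔤` and persist. So everywhere `|[,]|² · det
(G_ij) = 2 c² G_22²` (`bracketNormSqAt_mul_det`), and the square norm is an explicit rational
function of the entries of `G`. At `(t, p)`, where `G_ij = δ_ij`, a derivative with entries `V_ij`
gives `2 c² (V_22 - V_00 - V_11)`. Two differentiations of the same identity along the horizontal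
lift of a coordinate field give the Laplacian (`horDeriv_bracketNormSqAt`,
`laplacian_bracketNormSq`), the function on `P` being constant on fibres because `Ad` preserves the
bracket.

It remains to insert the equation for `∂G/∂t`. With `X` the coordinate field of the base, put `r =
g(X, X)`, `D_ij = DG(X)_ij`, `A_ij = H(X, b i, b j)` and `C = H(b 0, b 1, b 2)`. Second derivatives
and Christoffel terms cancel against the Laplacian. The squares of `D` that remain are `-2 c² (2
D_02² + 2 D_12² + (D_22 - D_00 - D_11)²) / r = -|T|²`. The bracket terms contribute `c², c², -c²` to
`V_00, V_11, V_22`, which yields `2 c² · (-3 c²) = -(3/2) |[,]|⁴`. The `H²` terms leave `-4 c² A_01²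
/ r - 2 c² C²`, the last two summands of `-S_A`. In this frame `S_A` is visibly a sum of squares
(`evolution_bracketNormSq`). -/

section Algebra

/-! ### Basis-independent traces and adapted bases of nilpotent Lie algebras. -/

variable {V : Type*} [AddCommGroup V] [Module ℝ V]

/-- A real function of two vectors that is linear in each of them. -/
structure IsBilin (S : V → V → ℝ) : Prop where
  left : ∀ y, IsLinearMap ℝ (fun x => S x y)
  right : ∀ x, IsLinearMap ℝ (fun y => S x y)

theorem IsLinearMap.map_sum_smul {ι W : Type*} [Fintype ι] [AddCommGroup W] [Module ℝ W]
    {f : V → W} (hf : IsLinearMap ℝ f)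
    (c : ι → ℝ) (b : ι → V) : f (∑ k, c k • b k) = ∑ k, c k • f (b k) := by
  refine (map_sum (IsLinearMap.mk' f hf) (fun k => c k • b k) Finset.univ).trans ?_
  exact Finset.sum_congr rfl fun k _ => hf.map_smul _ _

theorem IsBilin.expand {ι κ : Type*} [Fintype κ] {S : V → V → ℝ} (hS : IsBilin S)
    {e : ι → V} {b : κ → V} {C : Matrix ι κ ℝ} (h : ∀ i, e i = ∑ k, C i k • b k) (i j : ι) :
    S (e i) (e j) = ∑ k, ∑ l, C i k * C j l * S (b k) (b l) := by
  rw [h i, (hS.left _).map_sum_smul]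
  refine Finset.sum_congr rfl fun k _ => ?_
  rw [h j, (hS.right _).map_sum_smul, smul_eq_mul, Finset.mul_sum]
  refine Finset.sum_congr rfl fun l _ => ?_
  simp [mul_assoc]

/-- The trace of a bilinear form `S` with respect to the bilinear form `g`, computed in the family
of vectors `e`. -/
noncomputable def traceIn {ι : Type*} [Fintype ι] [DecidableEq ι] (e : ι → V) (g S : V → V → ℝ) :
    ℝ :=
  ∑ i, ∑ j, (Matrix.of fun i j => g (e i) (e j))⁻¹ i j * S (e i) (e j)

/-- Gram matrices change by the congruence `R ↦ C R Cᵀ`, and the trace of `g⁻¹ Sᵀ` is then unchanged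
by cyclicity. Nondegeneracy of `g` is not needed, since `Matrix.mul_inv_rev` also holds for singular
matrices. -/
theorem traceIn_eq_of_basis_change {ι : Type*} [Fintype ι] [DecidableEq ι] {e b : ι → V}
    {C : Matrix ι ι ℝ} (hC : IsUnit C.det) (h : ∀ i, e i = ∑ k, C i k • b k)
    {g S : V → V → ℝ} (hg : IsBilin g) (hS : IsBilin S) :
    traceIn e g S = traceIn b g S := by
  have key : ∀ R : V → V → ℝ, IsBilin R → (Matrix.of fun i j => R (e i) (e j)) =
      C * (Matrix.of fun i j => R (b i) (b j)) * C.transpose := by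
    intro R hR
    ext i j
    rw [Matrix.of_apply, hR.expand h]
    simp only [Matrix.mul_apply, Matrix.of_apply, Matrix.transpose_apply, Finset.sum_mul]
    rw [Finset.sum_comm]
    exact Finset.sum_congr rfl fun k _ => Finset.sum_congr rfl fun l _ => by ring
  have tr : ∀ d : ι → V, traceIn d g S =
      ((Matrix.of fun i j => g (d i) (d j))⁻¹ * (Matrix.of fun i j => S (d i) (d j)).transpose).trace
      := by
    intro d
    simp [traceIn, Matrix.trace, Matrix.mul_apply]
  rw [tr, tr, key g hg, key S hS, Matrix.mul_inv_rev, Matrix.mul_inv_rev, Matrix.transpose_mul,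
    Matrix.transpose_mul, Matrix.transpose_transpose]
  have hC' : IsUnit C.transpose.det := by rwa [Matrix.det_transpose]
  set A := (Matrix.of fun i j => g (b i) (b j))⁻¹
  set Q := (Matrix.of fun i j => S (b i) (b j)).transpose
  calc _ = (C.transpose⁻¹ * (A * (C⁻¹ * C) * Q * C.transpose)).trace := by
        simp only [Matrix.mul_assoc]
    _ = (A * Q).trace := by
        rw [Matrix.nonsing_inv_mul _ hC, Matrix.mul_one, Matrix.trace_mul_comm, Matrix.mul_assoc,
          Matrix.mul_nonsing_inv _ hC', Matrix.mul_one]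

theorem traceIn_eq_of_bases {ι : Type*} [Fintype ι] [DecidableEq ι] (e b : Module.Basis ι ℝ V)
    {g S : V → V → ℝ} (hg : IsBilin g) (hS : IsBilin S) :
    traceIn e g S = traceIn b g S := by
  refine traceIn_eq_of_basis_change (C := (b.toMatrix e).transpose) ?_ ?_ hg hS
  · rw [Matrix.det_transpose]
    exact Matrix.isUnit_det_of_left_inverse (Module.Basis.toMatrix_mul_toMatrix_flip e b)
  · intro i
    simp [Module.Basis.toMatrix_apply, b.sum_repr]

theorem traceIn_orthonormal {ι : Type*} [Fintype ι] [DecidableEq ι] {W : Type*} {b : ι → W}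
    {g S : W → W → ℝ} (hb : ∀ i j, g (b i) (b j) = if i = j then 1 else 0) :
    traceIn b g S = ∑ i, S (b i) (b i) := by
  have : (Matrix.of fun i j => g (b i) (b j)) = 1 := by
    ext i j
    simp [hb, Matrix.one_apply]
  simp [traceIn, this, Matrix.one_apply]

/-- Positive definite symmetric bilinear forms. -/
structure IsInner (g : V → V → ℝ) : Prop where
  bilin : IsBilin g
  symm : ∀ x y, g x y = g y x
  pos : ∀ x, x ≠ 0 → 0 < g x x

theorem linearIndependent_of_orthonormal {ι : Type*} [Fintype ι] [DecidableEq ι] {b : ι → V}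
    {g : V → V → ℝ} (hg : IsBilin g) (hb : ∀ i j, g (b i) (b j) = if i = j then 1 else 0) :
    LinearIndependent ℝ b := by
  rw [Fintype.linearIndependent_iff]
  intro c hc i
  have h := (hg.left (b i)).map_sum_smul c b
  rw [hc] at h
  simpa [hb, (hg.left (b i)).map_zero] using h.symm

/-- A nonzero vector is proportional to the last vector of some orthonormal basis. -/
theorem IsInner.exists_orthonormal_basis {g : V → V → ℝ} (hg : IsInner g)
    (hV : Module.finrank ℝ V = 3) {z : V} (hz : z ≠ 0) :
    ∃ b : Module.Basis (Fin 3) ℝ V, (∀ i j, g (b i) (b j) = if i = j then 1 else 0) ∧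
      ∃ c : ℝ, b 2 = c • z := by
  let core : InnerProductSpace.Core ℝ V :=
    { inner := g
      conj_inner_symm := fun x y => by simp [hg.symm x y]
      re_inner_nonneg := fun x => by
        by_cases hx : x = 0
        · simp [hx, (hg.bilin.left (0 : V)).map_zero]
        · exact (hg.pos x hx).le
      add_left := fun x y w => (hg.bilin.left w).map_add x y
      smul_left := fun x y r => by simpa using (hg.bilin.left y).map_smul r x
      definite := fun x hx => by
        by_contra h
        exact (hg.pos x h).ne' hx }
  let _ : NormedAddCommGroup V := core.toNormedAddCommGroup
  let _ : InnerProductSpace ℝ V := InnerProductSpace.ofCore core.toCore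
  have hi : ∀ x y : V, inner ℝ x y = g x y := fun _ _ => rfl
  have : FiniteDimensional ℝ V := FiniteDimensional.of_finrank_eq_succ hV
  -- Only the restriction of this constant family to the index `2` matters; the extension theorem
  -- supplies the other two vectors.
  let v : Fin 3 → V := fun _ => ‖z‖⁻¹ • z
  have hn : ‖z‖ ≠ 0 := norm_ne_zero_iff.mpr hz
  have hv : Orthonormal ℝ (Set.domRestrict ({2} : Set (Fin 3)) v) := by
    constructor
    · intro i
      simp [v, Set.domRestrict, norm_smul, hn]
    · intro i j hij
      exact absurd (Subsingleton.elim i j) hij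
  obtain ⟨b, hb⟩ := hv.exists_orthonormalBasis_extension_of_card_eq (by simp [hV])
  refine ⟨b.toBasis, fun i j => ?_, ‖z‖⁻¹, ?_⟩
  · have := orthonormal_iff_ite.mp b.orthonormal i j
    simpa [hi] using this
  · simpa [v] using hb 2 rfl

/-- Every inner product on a three-dimensional nilpotent Lie algebra has an orthonormal basis in
which the only nontrivial bracket is a multiple of the last, central, vector. -/
theorem exists_adapted_basis {L : Type*} [LieRing L] [LieAlgebra ℝ L] (hn : LieRing.IsNilpotent L)
    (hL : Module.finrank ℝ L = 3) {g : L → L → ℝ} (hg : IsInner g) :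
    ∃ b : Module.Basis (Fin 3) ℝ L, (∀ i j, g (b i) (b j) = if i = j then 1 else 0) ∧
      (∃ c : ℝ, ⁅b 0, b 1⁆ = c • b 2) ∧ ∀ x : L, ⁅x, b 2⁆ = 0 := by
  have : Nontrivial L := Module.nontrivial_of_finrank_pos (R := ℝ) (by omega)
  -- A nonzero nilpotent Lie algebra has nonzero centre; the last basis vector is taken there.
  have : Nontrivial (LieAlgebra.center ℝ L) := LieAlgebra.non_trivial_center_of_isNilpotent
  obtain ⟨⟨z, hz⟩, hz0⟩ := exists_ne (0 : LieAlgebra.center ℝ L)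
  have hz0' : z ≠ 0 := fun h => hz0 (Subtype.ext h)
  obtain ⟨b, hb, c, hc⟩ := hg.exists_orthonormal_basis hL hz0'
  have hcen : ∀ x : L, ⁅x, b 2⁆ = 0 := fun x => by
    rw [hc, lie_smul, (LieModule.mem_maxTrivSubmodule ℝ L L z).mp hz x, smul_zero]
  refine ⟨b, hb, ⟨b.repr ⁅b 0, b 1⁆ 2, ?_⟩, hcen⟩
  have : FiniteDimensional ℝ L := FiniteDimensional.of_finrank_eq_succ hL
  -- Nilpotent endomorphisms are traceless. Since `b 2` is central, the trace of `ad (b 0)` is the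
  -- `b 1`-component of `⁅b 0, b 1⁆`, and that of `ad (b 1)` is minus its `b 0`-component; only the
  -- `b 2`-component survives.
  have htr : ∀ x : L, ∑ i, b.repr ⁅x, b i⁆ i = 0 := by
    intro x
    have h1 : IsNilpotent (LieAlgebra.ad ℝ L x) := by
      obtain ⟨k, hk⟩ := LieModule.exists_forall_pow_toEnd_eq_zero ℝ L L
      exact ⟨k, hk x⟩
    have h2 := (LinearMap.isNilpotent_trace_of_isNilpotent h1).eq_zero
    rw [LinearMap.trace_eq_matrix_trace ℝ b, Matrix.trace] at h2
    simpa [LinearMap.toMatrix_apply] using h2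
  have h0 := htr (b 0)
  have h1 := htr (b 1)
  simp only [Fin.sum_univ_three, lie_self, hcen, map_zero, Finsupp.coe_zero, Pi.zero_apply,
    zero_add, add_zero] at h0 h1
  rw [← lie_skew, map_neg, Finsupp.neg_apply, neg_eq_zero] at h1
  have := b.sum_repr ⁅b 0, b 1⁆
  rw [Fin.sum_univ_three, h0, h1, zero_smul, zero_smul, zero_add, zero_add] at this
  exact this.symm

end Algebra

/-! ### Chain rule and directional derivatives. -/

section DirDeriv

/-- The chain rule, with the tangent vectors of all points regarded as vectors of the model
spaces. -/
theorem mfderiv_comp_apply_model {E E' E'' : Type*} [NormedAddCommGroup E] [NormedSpace ℝ E]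
    [NormedAddCommGroup E'] [NormedSpace ℝ E'] [NormedAddCommGroup E''] [NormedSpace ℝ E'']
    {X Y Z : Type*} [TopologicalSpace X] [ChartedSpace E X] [TopologicalSpace Y]
    [ChartedSpace E' Y] [TopologicalSpace Z] [ChartedSpace E'' Z] {f : X → Y} {g : Y → Z} {x : X}
    {y : Y} {k : X → Z} (hy : f x = y) (hk : g ∘ f =ᶠ[nhds x] k)
    (hg : MDifferentiableAt 𝓘(ℝ, E') 𝓘(ℝ, E'') g y) (hf : MDifferentiableAt 𝓘(ℝ, E) 𝓘(ℝ, E') f x)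
    (v : E) :
    (id (mfderiv 𝓘(ℝ, E) 𝓘(ℝ, E'') k x v) : E'') =
      mfderiv 𝓘(ℝ, E') 𝓘(ℝ, E'') g y (id (mfderiv 𝓘(ℝ, E) 𝓘(ℝ, E') f x v) : E') := by
  subst hy
  have h := (hg.hasMFDerivAt.comp x hf.hasMFDerivAt).congr_of_eventuallyEq hk.symm
  have := h.mfderiv
  exact congrArg (fun L : E →L[ℝ] E'' => L v) this

variable {E : Type*} [NormedAddCommGroup E] [NormedSpace ℝ E]
  {X : Type*} [TopologicalSpace X] [ChartedSpace E X]

theorem dirDeriv_add {f g : X → ℝ} {x : X} (hf : MDifferentiableAt 𝓘(ℝ, E) 𝓘(ℝ, ℝ) f x)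
    (hg : MDifferentiableAt 𝓘(ℝ, E) 𝓘(ℝ, ℝ) g x) (v : TangentSpace 𝓘(ℝ, E) x) :
    dirDeriv (fun y => f y + g y) x v = dirDeriv f x v + dirDeriv g x v :=
  congrArg (fun L => L v) (mvfderiv_add hf hg)

theorem dirDeriv_mul {f g : X → ℝ} {x : X} (hf : MDifferentiableAt 𝓘(ℝ, E) 𝓘(ℝ, ℝ) f x)
    (hg : MDifferentiableAt 𝓘(ℝ, E) 𝓘(ℝ, ℝ) g x) (v : TangentSpace 𝓘(ℝ, E) x) :
    dirDeriv (fun y => f y * g y) x v = f x * dirDeriv g x v + g x * dirDeriv f x v :=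
  congrArg (fun L => L v) (mvfderiv_mul hf hg)

theorem dirDeriv_const (c : ℝ) (x : X) (v : TangentSpace 𝓘(ℝ, E) x) :
    dirDeriv (fun _ : X => c) x v = 0 :=
  congrArg (fun L => L v) (mvfderiv_const (I := 𝓘(ℝ, E)) c (x := x))

theorem dirDeriv_const_mul {f : X → ℝ} {x : X} (c : ℝ)
    (hf : MDifferentiableAt 𝓘(ℝ, E) 𝓘(ℝ, ℝ) f x) (v : TangentSpace 𝓘(ℝ, E) x) :
    dirDeriv (fun y => c * f y) x v = c * dirDeriv f x v := by
  rw [dirDeriv_mul mdifferentiableAt_const hf, dirDeriv_const, mul_zero, add_zero]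

/-- The derivative of `f` along `Y` is the fibre component of the tangent map of `f` composed with
the section `Y`, and the tangent map of a smooth map is smooth. -/
theorem contMDiffAt_dirDeriv [IsManifold 𝓘(ℝ, E) 1 X] {f : X → ℝ} {U : Set X} (hU : IsOpen U)
    (hf : ContMDiffOn 𝓘(ℝ, E) 𝓘(ℝ, ℝ) ∞ f U)
    {Y : ∀ x : X, TangentSpace 𝓘(ℝ, E) x} {x : X} (hx : x ∈ U)
    (hY : ContMDiffAt 𝓘(ℝ, E) (𝓘(ℝ, E)).tangent ∞
      (fun x => (⟨x, Y x⟩ : TangentBundle 𝓘(ℝ, E) X)) x) :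
    ContMDiffAt 𝓘(ℝ, E) 𝓘(ℝ, ℝ) ∞ (fun y => dirDeriv f y (Y y)) x := by
  have h : ContMDiffOn (𝓘(ℝ, E)).tangent (𝓘(ℝ, ℝ)).tangent ∞
      (tangentMapWithin 𝓘(ℝ, E) 𝓘(ℝ, ℝ) f U) (Bundle.TotalSpace.proj ⁻¹' U) :=
    hf.contMDiffOn_tangentMapWithin (by simp) hU.uniqueMDiffOn
  have hmem : (Bundle.TotalSpace.proj ⁻¹' U : Set (TangentBundle 𝓘(ℝ, E) X)) ∈
      nhds (⟨x, Y x⟩ : TangentBundle 𝓘(ℝ, E) X) :=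
    (hU.preimage (FiberBundle.continuous_proj E (TangentSpace 𝓘(ℝ, E)))).mem_nhds hx
  have h2 := (h.contMDiffAt hmem).comp x hY
  have h3 := (Bundle.contMDiffAt_totalSpace.mp h2).2
  simp only [Function.comp_def, tangentMapWithin, trivializationAt_model_space_apply] at h3
  refine h3.congr_of_eventuallyEq ?_
  filter_upwards [hU.mem_nhds hx] with y hy
  rw [mfderivWithin_of_isOpen hU hy]
  rfl

end DirDeriv

/-! ### Local sections and fundamental fields of the principal bundle. -/

namespace PrincipalBundle

variable {𝒢 P M : Type*}
  [TopologicalSpace 𝒢] [ChartedSpace (EuclideanSpace ℝ (Fin 3)) 𝒢] [Group 𝒢]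
  [TopologicalSpace P] [ChartedSpace (EuclideanSpace ℝ (Fin 4)) P]
  [TopologicalSpace M] [ChartedSpace ℝ M] (B : PrincipalBundle 𝒢 P M)

theorem proj_pt (m : M) : B.proj (B.pt m) = m := Function.surjInv_eq B.proj_surjective m

theorem exists_act_eq {q q' : P} (h : B.proj q = B.proj q') : ∃ a, q' = B.act q a := by
  obtain ⟨U, -, hm, s, φ, -, -, -, -, h6⟩ := B.locally_trivial (B.proj q)
  have h1 := h6 q hm
  have h2 := h6 q' (by rw [Set.mem_preimage, ← h]; exact hm)
  refine ⟨(φ q)⁻¹ * φ q', ?_⟩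
  calc q' = B.act (s (B.proj q)) (φ q * ((φ q)⁻¹ * φ q')) := by
        rw [mul_inv_cancel_left, h, h2]
    _ = _ := by rw [B.act_mul, h1]

theorem exists_local_section (p : P) : ∃ s : M → P,
    ContMDiffAt 𝓘(ℝ, ℝ) (𝓡 4) ∞ s (B.proj p) ∧ (∀ᶠ u in nhds (B.proj p), B.proj (s u) = u) := by
  obtain ⟨U, hU, hm, s, φ, h1, h2, h3, -, h6⟩ := B.locally_trivial (B.proj p)
  refine ⟨s, h1.contMDiffAt (hU.mem_nhds hm), ?_⟩
  filter_upwards [hU.mem_nhds hm] with u hu using h3 u hu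

theorem smooth_act_right (p : P) : ContMDiff (𝓡 3) (𝓡 4) ∞ (fun a : 𝒢 => B.act p a) :=
  B.smooth_act.comp (contMDiff_const.prodMk contMDiff_id)

theorem smooth_act_left (a : 𝒢) : ContMDiff (𝓡 4) (𝓡 4) ∞ (fun q : P => B.act q a) :=
  B.smooth_act.comp (contMDiff_id.prodMk contMDiff_const)

/-- Fibres are single orbits, so a local section can be translated by a group element until it
passes through `p`. -/
theorem exists_section_through (p : P) : ∃ s : M → P,
    ContMDiffAt 𝓘(ℝ, ℝ) (𝓡 4) ∞ s (B.proj p) ∧ s (B.proj p) = p ∧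
      (∀ᶠ u in nhds (B.proj p), B.proj (s u) = u) := by
  obtain ⟨s, h1, h2⟩ := B.exists_local_section p
  obtain ⟨a, ha⟩ := B.exists_act_eq h2.self_of_nhds
  refine ⟨fun u => B.act (s u) a, (B.smooth_act_left a).contMDiffAt.comp _ h1, ha.symm, ?_⟩
  filter_upwards [h2] with u hu
  rw [B.proj_act, hu]

theorem dProj_surjective (p : P) : Function.Surjective (B.dProj p) := by
  obtain ⟨s, h1, h2, h3⟩ := B.exists_section_through p
  intro v
  refine ⟨(id (mfderiv 𝓘(ℝ, ℝ) (𝓡 4) s (B.proj p) v) : EuclideanSpace ℝ (Fin 4)), ?_⟩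
  have := mfderiv_comp_apply_model (k := id) h2 h3
    (B.smooth_proj.mdifferentiableAt (by simp)) (h1.mdifferentiableAt (by simp)) v
  rw [mfderiv_id] at this
  exact this.symm

theorem fund_add (p : P) (x y : GroupLieAlgebra (𝓡 3) 𝒢) :
    B.fund p (x + y) = B.fund p x + B.fund p y := by
  exact (mfderiv (𝓡 3) (𝓡 4) (fun a : 𝒢 => B.act p a) 1).map_add x y

theorem fund_smul (p : P) (c : ℝ) (x : GroupLieAlgebra (𝓡 3) 𝒢) :
    B.fund p (c • x) = c • B.fund p x := by
  exact (mfderiv (𝓡 3) (𝓡 4) (fun a : 𝒢 => B.act p a) 1).map_smul c x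

theorem dProj_fund (p : P) (x : GroupLieAlgebra (𝓡 3) 𝒢) : B.dProj p (B.fund p x) = 0 := by
  have h := mfderiv_comp_apply_model (k := fun _ => B.proj p) (B.act_one p)
    (Filter.Eventually.of_forall fun a => B.proj_act p a)
    (B.smooth_proj.mdifferentiableAt (by simp))
    ((B.smooth_act_right p).mdifferentiableAt (x := 1) (by simp)) x
  rw [mfderiv_const] at h
  exact h.symm

theorem fund_zero (p : P) : B.fund p 0 = 0 :=
  (mfderiv (𝓡 3) (𝓡 4) (fun a : 𝒢 => B.act p a) 1).map_zero

variable [LieGroup (𝓡 3) ∞ 𝒢]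

/-- In a trivialization `φ (p a) = φ(p) a`, so the derivative of `φ` composed with `fund p` is the
derivative of a left translation, which the inverse translation `k` undoes. -/
theorem fund_injective (p : P) : Function.Injective (B.fund p) := by
  intro x y hxy
  obtain ⟨U, hU, hm, s, φ, h1, h2, h3, h4, h5⟩ := B.locally_trivial (B.proj p)
  have hφ : MDifferentiableAt (𝓡 4) (𝓡 3) φ p :=
    (h2.contMDiffAt ((hU.preimage B.smooth_proj.continuous).mem_nhds hm)).mdifferentiableAt
      (by simp)
  have hact : ∀ a, φ (B.act p a) = φ p * a := fun a => by
    rw [← h5 p hm, ← B.act_mul, h4 _ hm, h4 _ hm]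
  let k : 𝒢 → 𝒢 := fun a => (φ p)⁻¹ * a
  have hk : ContMDiff (𝓡 3) (𝓡 3) ∞ k := contMDiff_mul_left
  have key : ∀ v : EuclideanSpace ℝ (Fin 3), v = mfderiv (𝓡 3) (𝓡 3) k (φ p)
      (id (mfderiv (𝓡 4) (𝓡 3) φ p (B.fund p v) : EuclideanSpace ℝ (Fin 3)) :
        EuclideanSpace ℝ (Fin 3)) := by
    intro v
    have e1 := mfderiv_comp_apply_model (f := fun a : 𝒢 => B.act p a) (g := φ) (x := 1)
      (k := fun a => φ p * a) (B.act_one p) (Filter.Eventually.of_forall hact) hφ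
      ((B.smooth_act_right p).mdifferentiableAt (by simp)) v
    have e2 := mfderiv_comp_apply_model (f := fun a : 𝒢 => φ p * a) (g := k) (x := 1) (k := id)
      (mul_one _) (Filter.Eventually.of_forall fun a => inv_mul_cancel_left _ _)
      (hk.mdifferentiableAt (by simp))
      ((contMDiff_mul_left (I := 𝓡 3) (n := ∞)).mdifferentiableAt (by simp)) v
    rw [mfderiv_id, e1] at e2
    exact e2
  have hx := key x
  rw [hxy] at hx
  exact hx.trans (key y).symm

/-- The fundamental field is the tangent map of the action `P × 𝒢 → P` applied to the smooth family
of vectors `(0, x)` at the points `(p, 1)`. -/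
theorem contMDiff_fund [IsManifold (𝓡 4) ∞ P] (x : GroupLieAlgebra (𝓡 3) 𝒢) :
    ContMDiff (𝓡 4) (𝓡 4).tangent ∞
      (fun p => (⟨p, B.fund p x⟩ : TangentBundle (𝓡 4) P)) := by
  let f₀ : P → TangentBundle (𝓡 4) P := fun p => ⟨p, 0⟩
  have s₀ : ContMDiff (𝓡 4) (𝓡 4).tangent ∞ f₀ := Bundle.contMDiff_zeroSection _ _
  let f₁ : P → TangentBundle (𝓡 3) 𝒢 := fun _ => ⟨1, x⟩
  have s₁ : ContMDiff (𝓡 4) (𝓡 3).tangent ∞ f₁ := contMDiff_const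
  have s₂ : ContMDiff ((𝓡 4).tangent.prod (𝓡 3).tangent) ((𝓡 4).prod (𝓡 3)).tangent ∞
      (equivTangentBundleProd (𝓡 4) P (𝓡 3) 𝒢).symm := contMDiff_equivTangentBundleProd_symm
  have s₃ : ContMDiff ((𝓡 4).prod (𝓡 3)).tangent (𝓡 4).tangent ∞
      (tangentMap ((𝓡 4).prod (𝓡 3)) (𝓡 4) (fun z : P × 𝒢 => B.act z.1 z.2)) :=
    B.smooth_act.contMDiff_tangentMap (by simp)
  have S := (s₃.comp s₂).comp (s₀.prodMk s₁)
  convert! S with p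
  · simp [f₀, f₁, tangentMap, B.act_one]
  · simp only [Function.comp_apply, tangentMap, f₀, f₁]
    rw [mfderiv_prod_eq_add_apply (B.smooth_act.mdifferentiableAt (by simp))]
    simp +instances only [fund]
    refine (Eq.trans (congrArg₂ (fun u v : EuclideanSpace ℝ (Fin 4) => u + v)
      (ContinuousLinearMap.map_zero _) rfl) (zero_add _)).symm

end PrincipalBundle

/-! ### The adjoint representation acts by Lie algebra automorphisms. -/

section Adjoint

variable {𝒢 : Type*} [TopologicalSpace 𝒢] [ChartedSpace (EuclideanSpace ℝ (Fin 3)) 𝒢] [Group 𝒢]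

/-- The adjoint representation, the derivative of a conjugation at the identity. -/
noncomputable def adjointRep (a : 𝒢) (x : GroupLieAlgebra (𝓡 3) 𝒢) : GroupLieAlgebra (𝓡 3) 𝒢 :=
  (mfderiv (𝓡 3) (𝓡 3) (fun b : 𝒢 => a * b * a⁻¹) 1 x : EuclideanSpace ℝ (Fin 3))

/-- The standard basis of the Lie algebra, as a basis. -/
noncomputable def lieModuleBasis (𝒢 : Type*) [TopologicalSpace 𝒢]
    [ChartedSpace (EuclideanSpace ℝ (Fin 3)) 𝒢] [Group 𝒢] :
    Module.Basis (Fin 3) ℝ (GroupLieAlgebra (𝓡 3) 𝒢) :=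
  (EuclideanSpace.basisFun (Fin 3) ℝ).toBasis

theorem coe_lieModuleBasis : ⇑(lieModuleBasis 𝒢) = lieBasis 𝒢 := by
  ext1 i
  exact (EuclideanSpace.basisFun (Fin 3) ℝ).coe_toBasis ▸ EuclideanSpace.basisFun_apply _ _ i

variable [LieGroup (𝓡 3) ∞ 𝒢]

theorem lieGroup_minSmoothness_three (𝒢 : Type*) [TopologicalSpace 𝒢]
    [ChartedSpace (EuclideanSpace ℝ (Fin 3)) 𝒢] [Group 𝒢] [LieGroup (𝓡 3) ∞ 𝒢] :
    LieGroup (𝓡 3) (minSmoothness ℝ 3) 𝒢 :=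
  LieGroup.of_le (I := 𝓡 3) (n := ∞) (by
    rw [minSmoothness_of_isRCLikeNormedField]
    exact ENat.LEInfty.out)

theorem contMDiff_conj (a : 𝒢) : ContMDiff (𝓡 3) (𝓡 3) ∞ (fun b : 𝒢 => a * b * a⁻¹) :=
  contMDiff_mul_right.comp contMDiff_mul_left

theorem mfderiv_conj_conj_inv (a g : 𝒢) (v : EuclideanSpace ℝ (Fin 3)) :
    (id (mfderiv (𝓡 3) (𝓡 3) (fun b : 𝒢 => a * b * a⁻¹) g
      (id (mfderiv (𝓡 3) (𝓡 3) (fun b : 𝒢 => a⁻¹ * b * a) (a * g * a⁻¹) v) :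
        EuclideanSpace ℝ (Fin 3))) : EuclideanSpace ℝ (Fin 3)) = v := by
  have h1 : ContMDiff (𝓡 3) (𝓡 3) ∞ (fun b : 𝒢 => a⁻¹ * b * a) := by
    simpa using contMDiff_conj a⁻¹
  have h := mfderiv_comp_apply_model (f := fun b : 𝒢 => a⁻¹ * b * a)
    (g := fun b : 𝒢 => a * b * a⁻¹) (x := a * g * a⁻¹) (y := g) (k := id) (by group)
    (Filter.Eventually.of_forall fun b => by simp [mul_assoc])
    ((contMDiff_conj a).mdifferentiableAt (by simp)) (h1.mdifferentiableAt (by simp)) v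
  rw [mfderiv_id] at h
  exact h.symm

theorem mfderiv_conj_inv_conj (a g : 𝒢) (v : EuclideanSpace ℝ (Fin 3)) :
    (id (mfderiv (𝓡 3) (𝓡 3) (fun b : 𝒢 => a⁻¹ * b * a) (a * g * a⁻¹)
      (id (mfderiv (𝓡 3) (𝓡 3) (fun b : 𝒢 => a * b * a⁻¹) g v) :
        EuclideanSpace ℝ (Fin 3))) : EuclideanSpace ℝ (Fin 3)) = v := by
  have h1 : ContMDiff (𝓡 3) (𝓡 3) ∞ (fun b : 𝒢 => a⁻¹ * b * a) := by
    simpa using contMDiff_conj a⁻¹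
  have h := mfderiv_comp_apply_model (f := fun b : 𝒢 => a * b * a⁻¹)
    (g := fun b : 𝒢 => a⁻¹ * b * a) (x := g) (k := id) rfl
    (Filter.Eventually.of_forall fun b => by simp [mul_assoc])
    (h1.mdifferentiableAt (by simp)) ((contMDiff_conj a).mdifferentiableAt (by simp)) v
  rw [mfderiv_id] at h
  exact h.symm

theorem adjointRep_adjointRep_inv (a : 𝒢) (x : GroupLieAlgebra (𝓡 3) 𝒢) :
    adjointRep a (adjointRep a⁻¹ x) = x := by
  have h := mfderiv_conj_conj_inv a 1 x
  rw [show a * 1 * a⁻¹ = (1 : 𝒢) by group] at h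
  have e : (fun b : 𝒢 => a⁻¹ * b * a⁻¹⁻¹) = fun b => a⁻¹ * b * a := by simp
  have hx : adjointRep a⁻¹ x =
      (mfderiv (𝓡 3) (𝓡 3) (fun b : 𝒢 => a⁻¹ * b * a) 1 x : EuclideanSpace ℝ (Fin 3)) :=
    congrArg (fun f : 𝒢 → 𝒢 =>
      (id (mfderiv (𝓡 3) (𝓡 3) f 1 x : EuclideanSpace ℝ (Fin 3)) : EuclideanSpace ℝ (Fin 3))) e
  rw [hx]
  exact h

/-- The adjoint representation as a linear automorphism of the Lie algebra. -/
noncomputable def adjointEquiv (a : 𝒢) :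
    GroupLieAlgebra (𝓡 3) 𝒢 ≃ₗ[ℝ] GroupLieAlgebra (𝓡 3) 𝒢 where
  toFun := adjointRep a
  map_add' := (mfderiv (𝓡 3) (𝓡 3) (fun b : 𝒢 => a * b * a⁻¹) 1).map_add
  map_smul' := (mfderiv (𝓡 3) (𝓡 3) (fun b : 𝒢 => a * b * a⁻¹) 1).map_smul
  invFun := adjointRep a⁻¹
  left_inv x := by simpa using adjointRep_adjointRep_inv a⁻¹ x
  right_inv := adjointRep_adjointRep_inv a

/-- Both sides come from differentiating `b ↦ a (g b) a⁻¹ = (a g a⁻¹)(a b a⁻¹)` at `b = 1`, once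
through each factorization. -/
theorem mpullback_conj_mulInvariantVectorField (a : 𝒢) (x : GroupLieAlgebra (𝓡 3) 𝒢) :
    VectorField.mpullback (𝓡 3) (𝓡 3) (fun b : 𝒢 => a * b * a⁻¹)
      (mulInvariantVectorField (adjointRep a x)) = mulInvariantVectorField x := by
  ext1 g
  have hinv : (mfderiv (𝓡 3) (𝓡 3) (fun b : 𝒢 => a * b * a⁻¹) g).IsInvertible :=
    ContinuousLinearMap.IsInvertible.of_inverse
      (g := (id (mfderiv (𝓡 3) (𝓡 3) (fun b : 𝒢 => a⁻¹ * b * a) (a * g * a⁻¹)) :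
        EuclideanSpace ℝ (Fin 3) →L[ℝ] EuclideanSpace ℝ (Fin 3)))
      (ContinuousLinearMap.ext fun v => mfderiv_conj_conj_inv a g v)
      (ContinuousLinearMap.ext fun v => mfderiv_conj_inv_conj a g v)
  rw [VectorField.mpullback_apply, hinv.inverse_apply_eq]
  have hm : ∀ h : 𝒢, ContMDiff (𝓡 3) (𝓡 3) ∞ (fun b : 𝒢 => h * b) := fun h => contMDiff_mul_left
  have e1 := mfderiv_comp_apply_model (f := fun b : 𝒢 => g * b)
    (g := fun b : 𝒢 => a * b * a⁻¹) (x := 1) (k := fun b => a * (g * b) * a⁻¹) (mul_one g)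
    (Filter.Eventually.of_forall fun b => rfl)
    ((contMDiff_conj a).mdifferentiableAt (by simp)) ((hm g).mdifferentiableAt (by simp)) x
  have e2 := mfderiv_comp_apply_model (f := fun b : 𝒢 => a * b * a⁻¹)
    (g := fun b : 𝒢 => a * g * a⁻¹ * b) (x := 1) (y := 1) (k := fun b => a * (g * b) * a⁻¹)
    (by group)
    (Filter.Eventually.of_forall fun b => by simp [mul_assoc])
    ((hm _).mdifferentiableAt (by simp)) ((contMDiff_conj a).mdifferentiableAt (by simp)) x
  exact e2.symm.trans e1

/-- The bracket of `𝔤` is that of left-invariant fields; pulling back by a conjugation commutes with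
brackets of fields and sends the left-invariant field of `Ad_a x` to that of `x`. -/
theorem adjointRep_lie (a : 𝒢) (x y : GroupLieAlgebra (𝓡 3) 𝒢) :
    adjointRep a ⁅x, y⁆ = ⁅adjointRep a x, adjointRep a y⁆ := by
  have := lieGroup_minSmoothness_three 𝒢
  have h := VectorField.mpullback_mlieBracket (I := 𝓡 3) (I' := 𝓡 3) (n := ∞) (x₀ := 1)
    (f := fun b : 𝒢 => a * b * a⁻¹) (V := mulInvariantVectorField (adjointRep a x))
    (W := mulInvariantVectorField (adjointRep a y))
    (mdifferentiableAt_mulInvariantVectorField _) (mdifferentiableAt_mulInvariantVectorField _)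
    (contMDiff_conj a).contMDiffAt (by
      rw [minSmoothness_of_isRCLikeNormedField]
      exact ENat.LEInfty.out)
  rw [mpullback_conj_mulInvariantVectorField, mpullback_conj_mulInvariantVectorField,
    ← mulInvariantVector_mlieBracket] at h
  -- Inserting `Ad_a Ad_{a⁻¹}` puts the generator of the bracket field in the form whose pullback is
  -- known.
  rw [← GroupLieAlgebra.bracket_def, ← GroupLieAlgebra.bracket_def,
    ← adjointRep_adjointRep_inv a ⁅adjointRep a x, adjointRep a y⁆,
    mpullback_conj_mulInvariantVectorField] at h
  have h1 : ∀ v : GroupLieAlgebra (𝓡 3) 𝒢, mulInvariantVectorField v 1 = v := by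
    intro v
    have : (fun b : 𝒢 => (1 : 𝒢) * b) = id := by ext; simp
    have h2 := (Filter.EventuallyEq.of_eq (l := nhds 1) this).mfderiv_eq (I := 𝓡 3) (I' := 𝓡 3)
    rw [mfderiv_id] at h2
    exact congrArg (fun L : EuclideanSpace ℝ (Fin 3) →L[ℝ] EuclideanSpace ℝ (Fin 3) => L v) h2
  rw [h1] at h
  rw [← h, adjointRep_adjointRep_inv]

theorem adjointRep_adBracket (a : 𝒢) (x y : GroupLieAlgebra (𝓡 3) 𝒢) :
    adjointRep a (adBracket x y) = adBracket (adjointRep a x) (adjointRep a y) := by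
  unfold adBracket
  rw [← adjointRep_lie]
  exact (adjointEquiv a).map_neg _

theorem isLinearMap_adBracket_left (y : GroupLieAlgebra (𝓡 3) 𝒢) :
    IsLinearMap ℝ (fun x => adBracket x y) := by
  have := lieGroup_minSmoothness_three 𝒢
  constructor
  · intro x x'
    simp only [adBracket, add_lie, neg_add]
  · intro c x
    simp only [adBracket, smul_lie, smul_neg]

theorem isLinearMap_adBracket_right (x : GroupLieAlgebra (𝓡 3) 𝒢) :
    IsLinearMap ℝ (fun y => adBracket x y) := by
  have := lieGroup_minSmoothness_three 𝒢
  constructor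
  · intro x x'
    simp only [adBracket, lie_add, neg_add]
  · intro c x
    simp only [adBracket, lie_smul, smul_neg]

theorem adBracket_swap (x y : GroupLieAlgebra (𝓡 3) 𝒢) : adBracket y x = -adBracket x y := by
  have := lieGroup_minSmoothness_three 𝒢
  simp [adBracket]

theorem adBracket_self (x : GroupLieAlgebra (𝓡 3) 𝒢) : adBracket x x = 0 := by
  have := lieGroup_minSmoothness_three 𝒢
  simp [adBracket]

theorem IsNilpotentLieGroup.exists_adapted_basis (h : IsNilpotentLieGroup 𝒢)
    {g : GroupLieAlgebra (𝓡 3) 𝒢 → GroupLieAlgebra (𝓡 3) 𝒢 → ℝ} (hg : IsInner g) :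
    ∃ b : Module.Basis (Fin 3) ℝ (GroupLieAlgebra (𝓡 3) 𝒢),
      (∀ i j, g (b i) (b j) = if i = j then 1 else 0) ∧
      (∃ c : ℝ, adBracket (b 0) (b 1) = c • b 2) ∧
      ∀ x : GroupLieAlgebra (𝓡 3) 𝒢, adBracket x (b 2) = 0 := by
  have := lieGroup_minSmoothness_three 𝒢
  have hr : Module.finrank ℝ (GroupLieAlgebra (𝓡 3) 𝒢) = 3 := by
    rw [Module.finrank_eq_card_basis (lieModuleBasis 𝒢)]
    rfl
  obtain ⟨b, h1, ⟨c, h2⟩, h3⟩ := _root_.exists_adapted_basis h hr hg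
  refine ⟨b, h1, ⟨-c, ?_⟩, fun x => ?_⟩
  · rw [adBracket, h2, neg_smul]
  · rw [adBracket, h3, neg_zero]

end Adjoint

/-! ### Equivariance of the fundamental fields. -/

namespace PrincipalBundle

variable {𝒢 P M : Type*}
  [TopologicalSpace 𝒢] [ChartedSpace (EuclideanSpace ℝ (Fin 3)) 𝒢] [Group 𝒢]
  [TopologicalSpace P] [ChartedSpace (EuclideanSpace ℝ (Fin 4)) P]
  [TopologicalSpace M] [ChartedSpace ℝ M] (B : PrincipalBundle 𝒢 P M)

/-- Differentiate `(p a) b = (p (a b a⁻¹)) a` at `b = 1`. -/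
theorem fund_act [LieGroup (𝓡 3) ∞ 𝒢] (p : P) (a : 𝒢) (x : GroupLieAlgebra (𝓡 3) 𝒢) :
    B.fund (B.act p a) x = B.dRight a p (B.fund p (adjointRep a x)) := by
  have e1 := mfderiv_comp_apply_model (f := fun b : 𝒢 => B.act p b)
    (g := fun q => B.act q a) (x := 1) (k := fun b => B.act p (b * a)) (B.act_one p)
    (Filter.Eventually.of_forall fun b => (B.act_mul p b a).symm)
    ((B.smooth_act_left a).mdifferentiableAt (by simp))
    ((B.smooth_act_right p).mdifferentiableAt (by simp)) (adjointRep a x)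
  have hm : ContMDiff (𝓡 3) (𝓡 4) ∞ (fun b : 𝒢 => B.act p (b * a)) :=
    (B.smooth_act_right p).comp contMDiff_mul_right
  have e2 := mfderiv_comp_apply_model (f := fun b : 𝒢 => a * b * a⁻¹)
    (g := fun b => B.act p (b * a)) (x := 1) (y := 1) (k := fun b => B.act (B.act p a) b) (by simp)
    (Filter.Eventually.of_forall fun b => by simp [← B.act_mul])
    (hm.mdifferentiableAt (by simp)) ((contMDiff_conj a).mdifferentiableAt (by simp)) x
  exact e2.trans e1

end PrincipalBundle

/-! ### Multilinearity of traces, and the square norm of a Heisenberg-type bracket. -/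

section Algebra

variable {V : Type*} [AddCommGroup V] [Module ℝ V]

theorem IsLinearMap.mul_const' {f : V → ℝ} (hf : IsLinearMap ℝ f) (c : ℝ) :
    IsLinearMap ℝ (fun x => f x * c) :=
  ⟨fun x y => by simp only [hf.map_add, add_mul],
    fun r x => by simp only [hf.map_smul, smul_eq_mul, mul_assoc]⟩

theorem IsLinearMap.const_mul' {f : V → ℝ} (hf : IsLinearMap ℝ f) (c : ℝ) :
    IsLinearMap ℝ (fun x => c * f x) :=
  ⟨fun x y => by simp only [hf.map_add, mul_add],
    fun r x => by simp only [hf.map_smul, smul_eq_mul]; ring⟩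

theorem IsLinearMap.add' {f g : V → ℝ} (hf : IsLinearMap ℝ f) (hg : IsLinearMap ℝ g) :
    IsLinearMap ℝ (fun x => f x + g x) :=
  ⟨fun x y => by simp only [hf.map_add, hg.map_add]; ring,
    fun r x => by simp only [hf.map_smul, hg.map_smul, smul_eq_mul]; ring⟩

theorem IsLinearMap.sub' {f g : V → ℝ} (hf : IsLinearMap ℝ f) (hg : IsLinearMap ℝ g) :
    IsLinearMap ℝ (fun x => f x - g x) :=
  ⟨fun x y => by simp only [hf.map_add, hg.map_add]; ring,
    fun r x => by simp only [hf.map_smul, hg.map_smul, smul_eq_mul]; ring⟩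

theorem IsLinearMap.sum' {ι : Type*} (s : Finset ι) {f : ι → V → ℝ}
    (hf : ∀ i, IsLinearMap ℝ (f i)) : IsLinearMap ℝ (fun x => ∑ i ∈ s, f i x) :=
  ⟨fun x y => by simp only [(hf _).map_add, Finset.sum_add_distrib],
    fun r x => by simp only [(hf _).map_smul, Finset.smul_sum]⟩

theorem IsLinearMap.comp' {W : Type*} [AddCommGroup W] [Module ℝ W] {f : W → ℝ} {A : V → W}
    (hf : IsLinearMap ℝ f) (hA : IsLinearMap ℝ A) : IsLinearMap ℝ (fun x => f (A x)) :=
  ⟨fun x y => by simp only [hA.map_add, hf.map_add],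
    fun r x => by simp only [hA.map_smul, hf.map_smul]⟩

theorem IsLinearMap.traceIn {W ι : Type*} [Fintype ι] [DecidableEq ι] {e : ι → W}
    {g : W → W → ℝ} {S : V → W → W → ℝ} (hS : ∀ w w', IsLinearMap ℝ (fun x => S x w w')) :
    IsLinearMap ℝ (fun x => traceIn e g (S x)) :=
  IsLinearMap.sum' _ fun _ => IsLinearMap.sum' _ fun _ => (hS _ _).const_mul' _

theorem IsBilin.mul {f g : V → ℝ} (hf : IsLinearMap ℝ f) (hg : IsLinearMap ℝ g) :
    IsBilin (fun x y => f x * g y) :=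
  ⟨fun _ => hf.mul_const' _, fun _ => hg.const_mul' _⟩

theorem IsBilin.comp {W : Type*} [AddCommGroup W] [Module ℝ W] {S : W → W → ℝ} (hS : IsBilin S)
    {A A' : V → W} (hA : IsLinearMap ℝ A) (hA' : IsLinearMap ℝ A') :
    IsBilin (fun x y => S (A x) (A' y)) :=
  ⟨fun _ => (hS.left _).comp' hA, fun _ => (hS.right _).comp' hA'⟩

theorem IsBilin.traceIn {W ι : Type*} [Fintype ι] [DecidableEq ι] {e : ι → W}
    {g : W → W → ℝ} {S : V → V → W → W → ℝ} (hS : ∀ w w', IsBilin (fun x y => S x y w w')) :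
    IsBilin (fun x y => traceIn e g (S x y)) :=
  ⟨fun _ => IsLinearMap.traceIn fun w w' => (hS w w').left _,
    fun _ => IsLinearMap.traceIn fun w w' => (hS w w').right _⟩

/-- A null vector of the Gram matrix would be the coordinate vector of some `x ≠ 0` with `g x x =
0`. -/
theorem IsInner.det_ne_zero {ι : Type*} [Fintype ι] [DecidableEq ι] {g : V → V → ℝ}
    (hg : IsInner g) (b : Module.Basis ι ℝ V) : (Matrix.of fun i j => g (b i) (b j)).det ≠ 0 := by
  intro h
  obtain ⟨v, hv0, hv⟩ := Matrix.exists_mulVec_eq_zero_iff.mpr h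
  have hx : ∑ j, v j • b j ≠ 0 := fun h0 =>
    hv0 (funext (Fintype.linearIndependent_iff.mp b.linearIndependent v h0))
  refine (hg.pos _ hx).ne' ?_
  rw [(hg.bilin.left _).map_sum_smul]
  refine Finset.sum_eq_zero fun i _ => ?_
  rw [(hg.bilin.right _).map_sum_smul]
  have := congrFun hv i
  simp only [Matrix.mulVec, dotProduct, Matrix.of_apply, Pi.zero_apply] at this
  simp only [smul_eq_mul]
  rw [Finset.sum_congr rfl fun j _ => mul_comm (v j) _, this, mul_zero]

/-- The square norm of a bracket whose only nontrivial value on basis vectors is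
`[b₀, b₁] = c b₂`. -/
theorem traceIn_traceIn_bracket {g : V → V → ℝ} (hg : IsInner g) (b : Module.Basis (Fin 3) ℝ V)
    {β : V → V → V} {c : ℝ} (h01 : β (b 0) (b 1) = c • b 2) (hself : ∀ x, β x x = 0)
    (hswap : ∀ x y, β y x = -β x y) (h2 : ∀ x, β x (b 2) = 0) :
    traceIn b g (fun x x' => traceIn b g fun y y' => g (β x y) (β x' y')) *
      (Matrix.of fun i j => g (b i) (b j)).det = 2 * c ^ 2 * g (b 2) (b 2) ^ 2 := by
  have hd := hg.det_ne_zero b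
  have h2' : ∀ x, β (b 2) x = 0 := fun x => by rw [hswap, h2, neg_zero]
  have h10 : β (b 1) (b 0) = (-c) • b 2 := by rw [hswap, h01, neg_smul]
  have z1 : ∀ x, g 0 x = 0 := fun x => (hg.bilin.left x).map_zero
  have z2 : ∀ x, g x 0 = 0 := fun x => (hg.bilin.right x).map_zero
  have hs : ∀ r r' : ℝ, g (r • b 2) (r' • b 2) = r * r' * g (b 2) (b 2) := fun r r' => by
    rw [(hg.bilin.left _).map_smul, (hg.bilin.right _).map_smul, smul_eq_mul, smul_eq_mul,
      mul_assoc]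
  simp only [traceIn, Fin.sum_univ_three, hself, h01, h10, h2, h2', z1, z2, hs, mul_zero,
    add_zero, zero_add]
  -- Only indices `0` and `1` survive, leaving `2 c² g_22` times the minor `g^{00} g^{11} - g^{01}
  -- g^{10}` of the inverse matrix. By Jacobi's identity this minor is `g_22 / det g`; here it is
  -- checked through the adjugate.
  have hinv : (Matrix.of fun i j => g (b i) (b j))⁻¹ =
      ((Matrix.of fun i j => g (b i) (b j)).det)⁻¹ •
        (Matrix.of fun i j => g (b i) (b j)).adjugate := by
    rw [Matrix.inv_def, Ring.inverse_eq_inv']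
  rw [hinv, Matrix.adjugate_fin_three]
  simp only [Matrix.smul_apply, Matrix.of_apply, Matrix.cons_val', Matrix.cons_val_zero,
    Matrix.cons_val_one, Matrix.cons_val_fin_one, smul_eq_mul]
  set d := (Matrix.of fun i j => g (b i) (b j)).det with hdd
  have hdet := hdd
  rw [Matrix.det_fin_three] at hdet
  simp only [Matrix.of_apply] at hdet
  field_simp
  rw [hdet]
  ring

end Algebra

/-! ### Invariance and smoothness of the square norm of the bracket. -/

namespace InvariantFamily

variable {𝒢 P M : Type*}
  [TopologicalSpace 𝒢] [ChartedSpace (EuclideanSpace ℝ (Fin 3)) 𝒢] [Group 𝒢]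
  [TopologicalSpace P] [ChartedSpace (EuclideanSpace ℝ (Fin 4)) P]
  [TopologicalSpace M] [ChartedSpace ℝ M]
  [IsManifold (𝓡 4) ∞ P] {B : PrincipalBundle 𝒢 P M} {J : Set ℝ} (F : InvariantFamily B J)

theorem isInner_metric (t : ℝ) (p : P) : IsInner (V := TangentSpace (𝓡 4) p)
    (fun x y => (F.metric t).inner p x y) where
  bilin := ⟨fun y => ⟨fun x x' => by simp, fun c x => by simp⟩,
    fun x => ⟨fun y y' => by simp, fun c y => by simp⟩⟩
  symm := (F.metric t).symm p
  pos := (F.metric t).pos p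

theorem trG_eq_traceIn (t : ℝ) (p : P)
    (S : GroupLieAlgebra (𝓡 3) 𝒢 → GroupLieAlgebra (𝓡 3) 𝒢 → ℝ) :
    F.trG t p S = traceIn (lieModuleBasis 𝒢) (F.G t p) S := by
  rw [coe_lieModuleBasis]
  rfl

theorem contMDiffAt_inner (t : ℝ) {p : P} {Y W : ∀ q : P, TangentSpace (𝓡 4) q}
    (hY : ContMDiffAt (𝓡 4) (𝓡 4).tangent ∞ (fun q => (⟨q, Y q⟩ : TangentBundle (𝓡 4) P)) p)
    (hW : ContMDiffAt (𝓡 4) (𝓡 4).tangent ∞ (fun q => (⟨q, W q⟩ : TangentBundle (𝓡 4) P)) p) :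
    ContMDiffAt (𝓡 4) 𝓘(ℝ, ℝ) ∞ (fun q => (F.metric t).inner q (Y q) (W q)) p := by
  have h := ContMDiffAt.clm_bundle_apply₂ (F₁ := EuclideanSpace ℝ (Fin 4))
    (F₂ := EuclideanSpace ℝ (Fin 4)) (F₃ := ℝ) (E₃ := fun _ : P => ℝ)
    ((F.metric t).contMDiff p) hY hW
  simpa using (Bundle.contMDiffAt_totalSpace.mp h).2

variable [LieGroup (𝓡 3) ∞ 𝒢]

theorem isInner_G (t : ℝ) (p : P) : IsInner (F.G t p) where
  bilin := (F.isInner_metric t p).bilin.comp ⟨B.fund_add p, B.fund_smul p⟩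
    ⟨B.fund_add p, B.fund_smul p⟩
  symm _ _ := (F.metric t).symm p _ _
  pos _ hx := (F.metric t).pos p _ fun h => hx (B.fund_injective p (h.trans (B.fund_zero p).symm))

theorem trG_eq_traceIn_basis (t : ℝ) (p : P)
    (b : Module.Basis (Fin 3) ℝ (GroupLieAlgebra (𝓡 3) 𝒢))
    {S : GroupLieAlgebra (𝓡 3) 𝒢 → GroupLieAlgebra (𝓡 3) 𝒢 → ℝ} (hS : IsBilin S) :
    F.trG t p S = traceIn b (F.G t p) S := by
  rw [trG_eq_traceIn, traceIn_eq_of_bases _ b (F.isInner_G t p).bilin hS]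

theorem contMDiff_G (t : ℝ) (x y : GroupLieAlgebra (𝓡 3) 𝒢) :
    ContMDiff (𝓡 4) 𝓘(ℝ, ℝ) ∞ (fun q => F.G t q x y) :=
  fun q => F.contMDiffAt_inner t (B.contMDiff_fund x q) (B.contMDiff_fund y q)

theorem G_act {t : ℝ} (ht : t ∈ J) (p : P) (a : 𝒢) (x y : GroupLieAlgebra (𝓡 3) 𝒢) :
    F.G t (B.act p a) x y = F.G t p (adjointRep a x) (adjointRep a y) := by
  unfold G
  rw [B.fund_act, B.fund_act, F.metric_invariant t ht]

/-- The square norm of the bracket, at a point of the total space. -/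
noncomputable def bracketNormSqAt (t : ℝ) (p : P) : ℝ :=
  F.trG t p fun a a' => F.trG t p fun b b' => F.G t p (adBracket a b) (adBracket a' b')

theorem isBilin_G_adBracket (t : ℝ) (p : P) (y y' : GroupLieAlgebra (𝓡 3) 𝒢) :
    IsBilin (fun x x' => F.G t p (adBracket x y) (adBracket x' y')) :=
  (F.isInner_G t p).bilin.comp (isLinearMap_adBracket_left y) (isLinearMap_adBracket_left y')

theorem isBilin_G_adBracket_right (t : ℝ) (p : P) (y y' : GroupLieAlgebra (𝓡 3) 𝒢) :
    IsBilin (fun x x' => F.G t p (adBracket y x) (adBracket y' x')) :=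
  (F.isInner_G t p).bilin.comp (isLinearMap_adBracket_right y) (isLinearMap_adBracket_right y')

theorem bracketNormSqAt_eq_traceIn (t : ℝ) (p : P)
    (b : Module.Basis (Fin 3) ℝ (GroupLieAlgebra (𝓡 3) 𝒢)) :
    F.bracketNormSqAt t p = traceIn b (F.G t p) fun x x' => traceIn b (F.G t p) fun y y' =>
      F.G t p (adBracket x y) (adBracket x' y') := by
  unfold bracketNormSqAt
  have : (fun x x' => F.trG t p fun y y' => F.G t p (adBracket x y) (adBracket x' y')) =
      fun x x' => traceIn b (F.G t p) fun y y' => F.G t p (adBracket x y) (adBracket x' y') := by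
    ext x x'
    exact F.trG_eq_traceIn_basis t p b (F.isBilin_G_adBracket_right t p x x')
  rw [this]
  exact F.trG_eq_traceIn_basis t p b (IsBilin.traceIn fun y y' => F.isBilin_G_adBracket t p y y')

/-- `G` at `p a` is `G` at `p` composed with `Ad_a`, which preserves the bracket. Computing at `p a`
in the standard basis and at `p` in its image under `Ad_a` produces identical sums. -/
theorem bracketNormSqAt_act {t : ℝ} (ht : t ∈ J) (p : P) (a : 𝒢) :
    F.bracketNormSqAt t (B.act p a) = F.bracketNormSqAt t p := by
  rw [F.bracketNormSqAt_eq_traceIn t (B.act p a) (lieModuleBasis 𝒢),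
    F.bracketNormSqAt_eq_traceIn t p ((lieModuleBasis 𝒢).map (adjointEquiv a))]
  have hA : ∀ i, ((lieModuleBasis 𝒢).map (adjointEquiv a)) i =
      adjointRep a (lieModuleBasis 𝒢 i) := fun i => rfl
  simp only [traceIn, hA, F.G_act ht, adjointRep_adBracket]

theorem bracketNormSq_proj {t : ℝ} (ht : t ∈ J) (p : P) :
    F.bracketNormSq t (B.proj p) = F.bracketNormSqAt t p := by
  obtain ⟨a, ha⟩ := B.exists_act_eq (B.proj_pt (B.proj p)).symm
  calc F.bracketNormSq t (B.proj p) = F.bracketNormSqAt t (B.pt (B.proj p)) := rfl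
    _ = _ := by rw [ha, F.bracketNormSqAt_act ht]

/-- The basis need not be orthonormal here. A basis adapted at one time and point therefore gives
this identity at all times and points with the same `c`, and it can be differentiated. -/
theorem bracketNormSqAt_mul_det (t : ℝ) (p : P)
    (b : Module.Basis (Fin 3) ℝ (GroupLieAlgebra (𝓡 3) 𝒢)) {c : ℝ}
    (h01 : adBracket (b 0) (b 1) = c • b 2)
    (h2 : ∀ x : GroupLieAlgebra (𝓡 3) 𝒢, adBracket x (b 2) = 0) :
    F.bracketNormSqAt t p * (Matrix.of fun i j => F.G t p (b i) (b j)).det =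
      2 * c ^ 2 * F.G t p (b 2) (b 2) ^ 2 := by
  rw [F.bracketNormSqAt_eq_traceIn t p b]
  exact traceIn_traceIn_bracket (F.isInner_G t p) b h01 adBracket_self adBracket_swap h2

theorem contMDiff_det_G (t : ℝ) (b : Fin 3 → GroupLieAlgebra (𝓡 3) 𝒢) :
    ContMDiff (𝓡 4) 𝓘(ℝ, ℝ) ∞ (fun q => (Matrix.of fun i j => F.G t q (b i) (b j)).det) := by
  have h := fun i j => F.contMDiff_G t (b i) (b j)
  simp only [Matrix.det_fin_three, Matrix.of_apply]
  exact ((((((h 0 0).mul (h 1 1)).mul (h 2 2)).sub (((h 0 0).mul (h 1 2)).mul (h 2 1))).sub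
    (((h 0 1).mul (h 1 0)).mul (h 2 2))).add (((h 0 1).mul (h 1 2)).mul (h 2 0))).add
    (((h 0 2).mul (h 1 0)).mul (h 2 1)) |>.sub (((h 0 2).mul (h 1 1)).mul (h 2 0))

theorem contMDiff_bracketNormSqAt (hnil : IsNilpotentLieGroup 𝒢) (t : ℝ) :
    ContMDiff (𝓡 4) 𝓘(ℝ, ℝ) ∞ (F.bracketNormSqAt t) := by
  intro p
  obtain ⟨b, -, ⟨c, h01⟩, h2⟩ := hnil.exists_adapted_basis (F.isInner_G t p)
  have he : F.bracketNormSqAt t = fun q => (2 * c ^ 2 * F.G t q (b 2) (b 2) ^ 2) /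
      (Matrix.of fun i j => F.G t q (b i) (b j)).det := by
    ext q
    rw [eq_div_iff ((F.isInner_G t q).det_ne_zero b), F.bracketNormSqAt_mul_det t q b h01 h2]
  rw [he]
  exact ((contMDiffAt_const.mul ((F.contMDiff_G t (b 2) (b 2) p).pow 2)).div₀
    (F.contMDiff_det_G t b p) ((F.isInner_G t p).det_ne_zero b))

theorem contMDiff_bracketNormSq (hnil : IsNilpotentLieGroup 𝒢) {t : ℝ} (ht : t ∈ J) :
    ContMDiff 𝓘(ℝ, ℝ) 𝓘(ℝ, ℝ) ∞ (F.bracketNormSq t) := by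
  intro m
  obtain ⟨p, rfl⟩ := B.proj_surjective m
  obtain ⟨s, h1, -, h3⟩ := B.exists_section_through p
  refine ((F.contMDiff_bracketNormSqAt hnil t).contMDiffAt.comp _ h1).congr_of_eventuallyEq ?_
  filter_upwards [h3] with u hu
  rw [Function.comp_apply, ← F.bracketNormSq_proj ht, hu]

end InvariantFamily

/-! ### The vertical space is the kernel of the projection. -/

namespace PrincipalBundle

variable {𝒢 P M : Type*}
  [TopologicalSpace 𝒢] [ChartedSpace (EuclideanSpace ℝ (Fin 3)) 𝒢] [Group 𝒢]
  [TopologicalSpace P] [ChartedSpace (EuclideanSpace ℝ (Fin 4)) P]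
  [TopologicalSpace M] [ChartedSpace ℝ M] (B : PrincipalBundle 𝒢 P M)

theorem isLinearMap_dProj (p : P) : IsLinearMap ℝ (B.dProj p) :=
  ⟨(mfderiv (𝓡 4) 𝓘(ℝ, ℝ) B.proj p).map_add, (mfderiv (𝓡 4) 𝓘(ℝ, ℝ) B.proj p).map_smul⟩

theorem isLinearMap_fund (p : P) : IsLinearMap ℝ (B.fund p) := ⟨B.fund_add p, B.fund_smul p⟩

/-- Dimension count: the range of `fund p` has dimension `3` and lies in the kernel of `dProj p`,
which has dimension `4 - 1`. -/
theorem exists_fund_eq [LieGroup (𝓡 3) ∞ 𝒢] {p : P} {Z : TangentSpace (𝓡 4) p}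
    (hZ : B.dProj p Z = 0) : ∃ x, B.fund p x = Z := by
  let f := IsLinearMap.mk' _ (B.isLinearMap_fund p)
  let d := IsLinearMap.mk' _ (B.isLinearMap_dProj p)
  have : FiniteDimensional ℝ (TangentSpace (𝓡 4) p) :=
    inferInstanceAs (FiniteDimensional ℝ (EuclideanSpace ℝ (Fin 4)))
  have : FiniteDimensional ℝ (GroupLieAlgebra (𝓡 3) 𝒢) :=
    inferInstanceAs (FiniteDimensional ℝ (EuclideanSpace ℝ (Fin 3)))
  have hle : LinearMap.range f ≤ LinearMap.ker d := by
    rintro _ ⟨x, rfl⟩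
    exact B.dProj_fund p x
  have e3 : Module.finrank ℝ (GroupLieAlgebra (𝓡 3) 𝒢) = 3 :=
    finrank_euclideanSpace_fin (𝕜 := ℝ)
  have e4 : Module.finrank ℝ (TangentSpace (𝓡 4) p) = 4 := finrank_euclideanSpace_fin (𝕜 := ℝ)
  have e1 : Module.finrank ℝ (TangentSpace 𝓘(ℝ, ℝ) (B.proj p)) = 1 := Module.finrank_self ℝ
  have h1 : Module.finrank ℝ (LinearMap.range f) = 3 :=
    (LinearMap.finrank_range_of_inj (f := f) (B.fund_injective p)).trans e3
  have h2 := LinearMap.finrank_range_add_finrank_ker d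
  rw [(LinearMap.range_eq_top (f := d)).mpr (B.dProj_surjective p), finrank_top, e4, e1] at h2
  have heq := Submodule.eq_of_le_of_finrank_eq hle (by omega)
  have : Z ∈ LinearMap.range f := by
    rw [heq]
    exact hZ
  exact this

end PrincipalBundle

/-! ### Coordinate fields on the one-dimensional base. -/

section CoordField

variable {M : Type*} [TopologicalSpace M] [ChartedSpace ℝ M] [IsManifold 𝓘(ℝ, ℝ) ∞ M]

theorem dirDeriv_chartAt_smul_coordField {m₀ m : M} (hm : m ∈ (chartAt ℝ m₀).source)
    (v : TangentSpace 𝓘(ℝ, ℝ) m) :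
    dirDeriv (chartAt ℝ m₀) m v • coordField m₀ m = v := by
  have hi : (mfderiv 𝓘(ℝ, ℝ) 𝓘(ℝ, ℝ) (chartAt ℝ m₀) m).IsInvertible := by
    have := isInvertible_mfderiv_extChartAt (I := 𝓘(ℝ, ℝ)) (x := m₀) (y := m) (by simpa using hm)
    simp only [mfld_simps] at this
    exact this
  refine Eq.trans ?_ ((hi.inverse_apply_eq (y := mfderiv 𝓘(ℝ, ℝ) 𝓘(ℝ, ℝ) (chartAt ℝ m₀) m v)).mpr
    rfl)
  refine Eq.trans ((mfderiv 𝓘(ℝ, ℝ) 𝓘(ℝ, ℝ) (chartAt ℝ m₀) m).inverse.map_smul _ _).symm ?_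
  have h1 : dirDeriv (chartAt ℝ m₀) m v * 1 = dirDeriv (chartAt ℝ m₀) m v := mul_one _
  exact congrArg _ h1

theorem dirDeriv_chartAt_coordField {m₀ m : M} (hm : m ∈ (chartAt ℝ m₀).source) :
    dirDeriv (chartAt ℝ m₀) m (coordField m₀ m) = 1 := by
  have hi : (mfderiv 𝓘(ℝ, ℝ) 𝓘(ℝ, ℝ) (chartAt ℝ m₀) m).IsInvertible := by
    have := isInvertible_mfderiv_extChartAt (I := 𝓘(ℝ, ℝ)) (x := m₀) (y := m) (by simpa using hm)
    simp only [mfld_simps] at this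
    exact this
  exact (hi.inverse_apply_eq.mp rfl).symm

theorem coordField_self_ne_zero (m : M) : coordField m m ≠ 0 := by
  intro h
  have := dirDeriv_chartAt_coordField (mem_chart_source ℝ m)
  rw [h] at this
  simp [dirDeriv] at this

end CoordField

/-! ### Existence, uniqueness and smoothness of horizontal lifts. -/

namespace InvariantFamily

variable {𝒢 P M : Type*}
  [TopologicalSpace 𝒢] [ChartedSpace (EuclideanSpace ℝ (Fin 3)) 𝒢] [Group 𝒢]
  [TopologicalSpace P] [ChartedSpace (EuclideanSpace ℝ (Fin 4)) P]
  [TopologicalSpace M] [ChartedSpace ℝ M]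
  [IsManifold (𝓡 4) ∞ P] {B : PrincipalBundle 𝒢 P M} {J : Set ℝ} (F : InvariantFamily B J)

/-- The component of a tangent vector orthogonal to the vertical space. -/
noncomputable def horPart (t : ℝ) (p : P) (Z : TangentSpace (𝓡 4) p) : TangentSpace (𝓡 4) p :=
  Z - ∑ i, ∑ j, (F.Ginv t p i j * (F.metric t).inner p Z (B.fund p (lieBasis 𝒢 i))) •
    B.fund p (lieBasis 𝒢 j)

theorem dProj_horPart (t : ℝ) (p : P) (Z : TangentSpace (𝓡 4) p) :
    B.dProj p (F.horPart t p Z) = B.dProj p Z := by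
  have hd := B.isLinearMap_dProj p
  unfold horPart
  rw [hd.map_sub]
  have h : ∀ i, B.dProj p (∑ j, (F.Ginv t p i j *
      (F.metric t).inner p Z (B.fund p (lieBasis 𝒢 i))) • B.fund p (lieBasis 𝒢 j)) = 0 := fun i => by
    rw [hd.map_sum_smul]
    simp [B.dProj_fund]
  have h2 := map_sum (IsLinearMap.mk' _ hd) (fun i => ∑ j, (F.Ginv t p i j *
      (F.metric t).inner p Z (B.fund p (lieBasis 𝒢 i))) • B.fund p (lieBasis 𝒢 j)) Finset.univ
  simp only [IsLinearMap.mk'_apply, h, Finset.sum_const_zero] at h2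
  rw [h2, sub_zero]

variable [LieGroup (𝓡 3) ∞ 𝒢]

theorem inner_horPart_fund (t : ℝ) (p : P) (Z : TangentSpace (𝓡 4) p)
    (x : GroupLieAlgebra (𝓡 3) 𝒢) : (F.metric t).inner p (F.horPart t p Z) (B.fund p x) = 0 := by
  have key : ∀ k, (F.metric t).inner p (F.horPart t p Z) (B.fund p (lieBasis 𝒢 k)) = 0 := by
    intro k
    have hdet := (F.isInner_G t p).det_ne_zero (lieModuleBasis 𝒢)
    rw [coe_lieModuleBasis] at hdet
    have hinv : F.Ginv t p * (Matrix.of fun i j => F.G t p (lieBasis 𝒢 i) (lieBasis 𝒢 j)) = 1 :=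
      Matrix.nonsing_inv_mul _ (isUnit_iff_ne_zero.mpr hdet)
    unfold horPart
    simp only [map_sub, map_sum, map_smul, sub_apply,
      sum_apply, smul_apply, smul_eq_mul]
    rw [sub_eq_zero]
    have : ∀ i, ∑ j, F.Ginv t p i j * (F.metric t).inner p Z (B.fund p (lieBasis 𝒢 i)) *
        (F.metric t).inner p (B.fund p (lieBasis 𝒢 j)) (B.fund p (lieBasis 𝒢 k)) =
        (if i = k then 1 else 0) * (F.metric t).inner p Z (B.fund p (lieBasis 𝒢 i)) := by
      intro i
      have h := congrFun (congrFun hinv i) k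
      rw [Matrix.mul_apply, Matrix.one_apply] at h
      rw [← h, Finset.sum_mul]
      exact Finset.sum_congr rfl fun j _ => by
        rw [Matrix.of_apply, G]
        ring
    rw [Finset.sum_congr rfl fun i _ => this i]
    simp
  have hx := (lieModuleBasis 𝒢).sum_repr x
  rw [coe_lieModuleBasis] at hx
  rw [← hx, (B.isLinearMap_fund p).map_sum_smul]
  simp [key]

/-- As `hor` is a choice, it has its defining property once some vector does: the horizontal part of
any lift of `v`. -/
theorem hor_spec (t : ℝ) (p : P) (v : TangentSpace 𝓘(ℝ, ℝ) (B.proj p)) :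
    B.dProj p (F.hor t p v) = v ∧
      ∀ x, (F.metric t).inner p (F.hor t p v) (B.fund p x) = 0 := by
  obtain ⟨Z, hZ⟩ := B.dProj_surjective p v
  exact Classical.epsilon_spec (p := fun Z : TangentSpace (𝓡 4) p =>
    B.dProj p Z = v ∧ ∀ x, (F.metric t).inner p Z (B.fund p x) = 0)
    ⟨F.horPart t p Z, (F.dProj_horPart t p Z).trans hZ, F.inner_horPart_fund t p Z⟩

/-- Two such lifts differ by a vertical vector orthogonal to the vertical space, hence of length
zero. -/
theorem eq_hor {t : ℝ} {p : P} {v : TangentSpace 𝓘(ℝ, ℝ) (B.proj p)} {Z : TangentSpace (𝓡 4) p}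
    (h1 : B.dProj p Z = v) (h2 : ∀ x, (F.metric t).inner p Z (B.fund p x) = 0) :
    Z = F.hor t p v := by
  obtain ⟨k1, k2⟩ := F.hor_spec t p v
  obtain ⟨x, hx⟩ := B.exists_fund_eq (p := p) (Z := Z - F.hor t p v)
    (by rw [(B.isLinearMap_dProj p).map_sub, h1, k1, sub_self])
  by_contra hne
  have h3 : (F.metric t).inner p (Z - F.hor t p v) (B.fund p x) = 0 := by
    rw [map_sub, sub_apply, h2, k2, sub_zero]
  rw [hx] at h3
  exact ((F.metric t).pos p _ (sub_ne_zero.mpr hne)).ne' h3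

theorem contMDiff_Ginv (t : ℝ) (i j : Fin 3) :
    ContMDiff (𝓡 4) 𝓘(ℝ, ℝ) ∞ (fun q => F.Ginv t q i j) := by
  intro q
  have hdet : ∀ q, (Matrix.of fun i j => F.G t q (lieBasis 𝒢 i) (lieBasis 𝒢 j)).det ≠ 0 := by
    intro q
    have := (F.isInner_G t q).det_ne_zero (lieModuleBasis 𝒢)
    rwa [coe_lieModuleBasis] at this
  have hd := F.contMDiff_det_G t (lieBasis 𝒢)
  have h := fun i j => F.contMDiff_G t (lieBasis 𝒢 i) (lieBasis 𝒢 j)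
  have he : (fun q => F.Ginv t q i j) = fun q =>
      (Matrix.of fun i j => F.G t q (lieBasis 𝒢 i) (lieBasis 𝒢 j)).adjugate i j /
      (Matrix.of fun i j => F.G t q (lieBasis 𝒢 i) (lieBasis 𝒢 j)).det := by
    ext q
    rw [Ginv, Matrix.inv_def, Ring.inverse_eq_inv', Matrix.smul_apply, smul_eq_mul, mul_comm,
      div_eq_mul_inv]
  rw [he]
  refine ContMDiffAt.div₀ ?_ (hd q) (hdet q)
  have hq := fun i j => h i j q
  simp only [Matrix.adjugate_fin_three]
  fin_cases i <;> fin_cases j <;>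
    simp only [Matrix.of_apply, Fin.zero_eta, Fin.mk_one, Fin.reduceFinMk, Matrix.cons_val',
      Matrix.cons_val_zero, Matrix.cons_val_one, Matrix.cons_val, Matrix.cons_val_fin_one]
  all_goals first
    | exact ((hq _ _).mul (hq _ _)).sub ((hq _ _).mul (hq _ _))
    | exact ((hq _ _).mul (hq _ _)).neg.add ((hq _ _).mul (hq _ _))

theorem contMDiffAt_horPart (t : ℝ) {p : P} {Y : ∀ q : P, TangentSpace (𝓡 4) q}
    (hY : ContMDiffAt (𝓡 4) (𝓡 4).tangent ∞ (fun q => (⟨q, Y q⟩ : TangentBundle (𝓡 4) P)) p) :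
    ContMDiffAt (𝓡 4) (𝓡 4).tangent ∞
      (fun q => (⟨q, F.horPart t q (Y q)⟩ : TangentBundle (𝓡 4) P)) p := by
  refine hY.sub_section (ContMDiffAt.sum_section fun i _ => ContMDiffAt.sum_section fun j _ => ?_)
  exact ContMDiffAt.smul_section
    ((F.contMDiff_Ginv t i j p).mul (F.contMDiffAt_inner t hY (B.contMDiff_fund _ p)))
    (B.contMDiff_fund (lieBasis 𝒢 j) p)

variable [IsManifold 𝓘(ℝ, ℝ) ∞ M]

/-- `hor` is chosen pointwise, so smoothness has to come from a formula. Extend one lift at `p` to a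
smooth field `Z`, take its horizontal part, and divide by the rate `c` at which `Z` moves the chart
coordinate; `c` equals `1` at `p`, so it is nonzero nearby. Uniqueness of lifts identifies the
result with `hor`. -/
theorem contMDiffAt_hor_coordField (t : ℝ) (p : P) :
    ContMDiffAt (𝓡 4) (𝓡 4).tangent ∞ (fun q =>
      (⟨q, F.hor t q (coordField (B.proj p) (B.proj q))⟩ : TangentBundle (𝓡 4) P)) p := by
  obtain ⟨Z₀, hZ₀⟩ := B.dProj_surjective p (coordField (B.proj p) (B.proj p))
  let Z : ∀ q : P, TangentSpace (𝓡 4) q := FiberBundle.extend (EuclideanSpace ℝ (Fin 4)) Z₀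
  have hZp : Z p = Z₀ := FiberBundle.extend_apply_self _ _
  have hZ : ContMDiffAt (𝓡 4) (𝓡 4).tangent ∞ (fun q => (⟨q, Z q⟩ : TangentBundle (𝓡 4) P)) p :=
    FiberBundle.contMDiffAt_extend (𝓡 4) (EuclideanSpace ℝ (Fin 4)) Z₀
  let χ : M → ℝ := chartAt ℝ (B.proj p)
  have hsrc : IsOpen (B.proj ⁻¹' (chartAt ℝ (B.proj p)).source) :=
    (chartAt ℝ (B.proj p)).open_source.preimage B.smooth_proj.continuous
  have hχ : ContMDiffOn 𝓘(ℝ, ℝ) 𝓘(ℝ, ℝ) ∞ χ (chartAt ℝ (B.proj p)).source := contMDiffOn_chart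
  have hχ' : ContMDiffOn (𝓡 4) 𝓘(ℝ, ℝ) ∞ (fun q => χ (B.proj q))
      (B.proj ⁻¹' (chartAt ℝ (B.proj p)).source) :=
    hχ.comp B.smooth_proj.contMDiffOn fun _ hq => hq
  have hp : p ∈ B.proj ⁻¹' (chartAt ℝ (B.proj p)).source := mem_chart_source ℝ (B.proj p)
  let c : P → ℝ := fun q => dirDeriv (fun q => χ (B.proj q)) q (Z q)
  have hc : ContMDiffAt (𝓡 4) 𝓘(ℝ, ℝ) ∞ c p := contMDiffAt_dirDeriv hsrc hχ' hp hZ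
  have hcq : ∀ q ∈ B.proj ⁻¹' (chartAt ℝ (B.proj p)).source,
      c q = dirDeriv χ (B.proj q) (B.dProj q (Z q)) := by
    intro q hq
    exact mfderiv_comp_apply_model (f := B.proj) (g := χ) rfl Filter.EventuallyEq.rfl
      ((hχ.contMDiffAt ((chartAt ℝ (B.proj p)).open_source.mem_nhds hq)).mdifferentiableAt
        (by simp)) (B.smooth_proj.mdifferentiableAt (by simp)) (Z q)
  have hcp : c p = 1 := by
    rw [hcq p hp, hZp, hZ₀]
    exact dirDeriv_chartAt_coordField (mem_chart_source ℝ (B.proj p))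
  have hY := (hc.inv₀ (by rw [hcp]; exact one_ne_zero)).smul_section (F.contMDiffAt_horPart t hZ)
  refine hY.congr_of_eventuallyEq ?_
  filter_upwards [hsrc.mem_nhds hp, hc.continuousAt.eventually_ne (by rw [hcp]; exact one_ne_zero)]
    with q hq hcne
  have hcne' : c q ≠ 0 := hcne
  congr 1
  symm
  refine F.eq_hor ?_ fun x => ?_
  · change B.dProj q ((c q)⁻¹ • F.horPart t q (Z q)) = _
    rw [(B.isLinearMap_dProj q).map_smul, F.dProj_horPart,
      ← dirDeriv_chartAt_smul_coordField hq (B.dProj q (Z q))]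
    change (c q)⁻¹ • dirDeriv χ (B.proj q) (B.dProj q (Z q)) • _ = _
    rw [← hcq q hq, inv_smul_smul₀ hcne']
  · change (F.metric t).inner q ((c q)⁻¹ • F.horPart t q (Z q)) _ = 0
    rw [map_smul, smul_apply, F.inner_horPart_fund, smul_zero]

end InvariantFamily

/-! ### Time derivative, horizontal two-jets and Laplacian of the square norm. -/

namespace InvariantFamily

variable {𝒢 P M : Type*}
  [TopologicalSpace 𝒢] [ChartedSpace (EuclideanSpace ℝ (Fin 3)) 𝒢] [Group 𝒢]
  [TopologicalSpace P] [ChartedSpace (EuclideanSpace ℝ (Fin 4)) P]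
  [TopologicalSpace M] [ChartedSpace ℝ M]
  [IsManifold (𝓡 4) ∞ P] {B : PrincipalBundle 𝒢 P M} {J : Set ℝ} (F : InvariantFamily B J)

/-- The derivative of a function on the total space along the horizontal lift of the coordinate
vector field of the chart at `proj p`. -/
noncomputable def horDeriv (t : ℝ) (p : P) (φ : P → ℝ) (q : P) : ℝ :=
  dirDeriv φ q (F.hor t q (coordField (B.proj p) (B.proj q)))

/-- The value and the first two horizontal derivatives of a smooth function at a point. -/
structure HasHorJet (t : ℝ) (p : P) (φ : P → ℝ) (a₀ a₁ a₂ : ℝ) : Prop where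
  smooth : ContMDiff (𝓡 4) 𝓘(ℝ, ℝ) ∞ φ
  eq₀ : φ p = a₀
  eq₁ : F.horDeriv t p φ p = a₁
  eq₂ : F.horDeriv t p (F.horDeriv t p φ) p = a₂

theorem hasHorJet_const (t : ℝ) (p : P) (c : ℝ) : F.HasHorJet t p (fun _ => c) c 0 0 where
  smooth := contMDiff_const
  eq₀ := rfl
  eq₁ := dirDeriv_const _ _ _
  eq₂ := by
    have : F.horDeriv t p (fun _ => c) = fun _ => 0 := funext fun q => dirDeriv_const _ _ _
    rw [this]
    exact dirDeriv_const _ _ _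

/-- The second horizontal derivative of `G(x, y)`. -/
noncomputable def D2G (t : ℝ) (p : P) (x y : GroupLieAlgebra (𝓡 3) 𝒢) : ℝ :=
  F.horDeriv t p (F.horDeriv t p fun q => F.G t q x y) p

variable [LieGroup (𝓡 3) ∞ 𝒢]

theorem hasHorJet_G (t : ℝ) (p : P) (x y : GroupLieAlgebra (𝓡 3) 𝒢) :
    F.HasHorJet t p (fun q => F.G t q x y) (F.G t p x y)
      (F.DG t p (coordField (B.proj p) (B.proj p)) x y) (F.D2G t p x y) :=
  ⟨F.contMDiff_G t x y, rfl, rfl, rfl⟩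

theorem DG_symm (t : ℝ) (p : P) (v : TangentSpace 𝓘(ℝ, ℝ) (B.proj p)) (x y : GroupLieAlgebra (𝓡 3) 𝒢) :
    F.DG t p v x y = F.DG t p v y x := by
  unfold DG
  simp only [(F.isInner_G t _).symm x y]

/-- The time derivative of the square norm of the bracket, in an adapted orthonormal basis. -/
theorem hasDerivWithinAt_bracketNormSqAt {t : ℝ} {p : P}
    (b : Module.Basis (Fin 3) ℝ (GroupLieAlgebra (𝓡 3) 𝒢))
    (hb : ∀ i j, F.G t p (b i) (b j) = if i = j then 1 else 0) {c : ℝ}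
    (h01 : adBracket (b 0) (b 1) = c • b 2)
    (h2 : ∀ x : GroupLieAlgebra (𝓡 3) 𝒢, adBracket x (b 2) = 0)
    {V : Fin 3 → Fin 3 → ℝ}
    (hV : ∀ i j, HasDerivWithinAt (fun s => F.G s p (b i) (b j)) (V i j) J t) :
    HasDerivWithinAt (fun s => F.bracketNormSqAt s p)
      (2 * c ^ 2 * (V 2 2 - V 0 0 - V 1 1)) J t := by
  -- The basis is orthonormal at time `t` only, but the quotient formula holds at every `s`. At `t`
  -- the derivative of the determinant is the trace of `V`.
  have he : (fun s => F.bracketNormSqAt s p) = fun s =>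
      (2 * c ^ 2 * (F.G s p (b 2) (b 2) * F.G s p (b 2) (b 2))) /
      (Matrix.of fun i j => F.G s p (b i) (b j)).det := by
    ext s
    rw [eq_div_iff ((F.isInner_G s p).det_ne_zero b), F.bracketNormSqAt_mul_det s p b h01 h2, sq (F.G _ _ _ _)]
  have hdet := (((((((hV 0 0).mul (hV 1 1)).mul (hV 2 2)).sub
    (((hV 0 0).mul (hV 1 2)).mul (hV 2 1))).sub
    (((hV 0 1).mul (hV 1 0)).mul (hV 2 2))).add (((hV 0 1).mul (hV 1 2)).mul (hV 2 0))).add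
    (((hV 0 2).mul (hV 1 0)).mul (hV 2 1))).sub (((hV 0 2).mul (hV 1 1)).mul (hV 2 0))
  have hne := (F.isInner_G t p).det_ne_zero b
  rw [he]
  simp only [Matrix.det_fin_three, Matrix.of_apply] at hne ⊢
  have hq := (((hV 2 2).mul (hV 2 2)).const_mul (2 * c ^ 2)).div hdet hne
  convert! hq using 1
  simp [hb]
  ring

variable [IsManifold 𝓘(ℝ, ℝ) ∞ M]

/-- Smoothness is claimed at `p` alone, since the field along which `φ` is differentiated comes from
the chart at `proj p`. This suffices for second derivatives at `p`. -/
theorem contMDiffAt_horDeriv (t : ℝ) (p : P) {φ : P → ℝ} (hφ : ContMDiff (𝓡 4) 𝓘(ℝ, ℝ) ∞ φ) :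
    ContMDiffAt (𝓡 4) 𝓘(ℝ, ℝ) ∞ (F.horDeriv t p φ) p :=
  contMDiffAt_dirDeriv isOpen_univ hφ.contMDiffOn (Set.mem_univ p)
    (F.contMDiffAt_hor_coordField t p)

theorem mdifferentiableAt_horDeriv (t : ℝ) (p : P) {φ : P → ℝ}
    (hφ : ContMDiff (𝓡 4) 𝓘(ℝ, ℝ) ∞ φ) :
    MDifferentiableAt (𝓡 4) 𝓘(ℝ, ℝ) (F.horDeriv t p φ) p :=
  (F.contMDiffAt_horDeriv t p hφ).mdifferentiableAt (by simp)

variable {F} {t : ℝ} {p : P} {φ ψ : P → ℝ} {a₀ a₁ a₂ b₀ b₁ b₂ : ℝ}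

theorem HasHorJet.add (hφ : F.HasHorJet t p φ a₀ a₁ a₂) (hψ : F.HasHorJet t p ψ b₀ b₁ b₂) :
    F.HasHorJet t p (fun q => φ q + ψ q) (a₀ + b₀) (a₁ + b₁) (a₂ + b₂) := by
  have h : F.horDeriv t p (fun q => φ q + ψ q) =
      fun q => F.horDeriv t p φ q + F.horDeriv t p ψ q := funext fun q =>
    dirDeriv_add (hφ.smooth.mdifferentiableAt (by simp)) (hψ.smooth.mdifferentiableAt (by simp)) _
  refine ⟨hφ.smooth.add hψ.smooth, by rw [hφ.eq₀, hψ.eq₀], (congrFun h p).trans (by rw [hφ.eq₁, hψ.eq₁]), ?_⟩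
  rw [h, ← hφ.eq₂, ← hψ.eq₂]
  exact dirDeriv_add (F.mdifferentiableAt_horDeriv t p hφ.smooth)
    (F.mdifferentiableAt_horDeriv t p hψ.smooth) _

theorem HasHorJet.mul (hφ : F.HasHorJet t p φ a₀ a₁ a₂) (hψ : F.HasHorJet t p ψ b₀ b₁ b₂) :
    F.HasHorJet t p (fun q => φ q * ψ q) (a₀ * b₀) (a₀ * b₁ + b₀ * a₁)
      (a₀ * b₂ + 2 * a₁ * b₁ + b₀ * a₂) := by
  have dφ := hφ.smooth.mdifferentiableAt (x := p) (by simp)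
  have dψ := hψ.smooth.mdifferentiableAt (x := p) (by simp)
  have dφ' := F.mdifferentiableAt_horDeriv t p hφ.smooth
  have dψ' := F.mdifferentiableAt_horDeriv t p hψ.smooth
  have h : F.horDeriv t p (fun q => φ q * ψ q) =
      fun q => φ q * F.horDeriv t p ψ q + ψ q * F.horDeriv t p φ q := funext fun q =>
    dirDeriv_mul (hφ.smooth.mdifferentiableAt (by simp)) (hψ.smooth.mdifferentiableAt (by simp)) _
  refine ⟨hφ.smooth.mul hψ.smooth, by rw [hφ.eq₀, hψ.eq₀],
    (congrFun h p).trans (by rw [hφ.eq₁, hψ.eq₁, hφ.eq₀, hψ.eq₀]), ?_⟩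
  rw [h]
  have h2 : F.horDeriv t p (fun q => φ q * F.horDeriv t p ψ q + ψ q * F.horDeriv t p φ q) p =
      (φ p * F.horDeriv t p (F.horDeriv t p ψ) p + F.horDeriv t p ψ p * F.horDeriv t p φ p) +
      (ψ p * F.horDeriv t p (F.horDeriv t p φ) p + F.horDeriv t p φ p * F.horDeriv t p ψ p) :=
    (dirDeriv_add (dφ.mul dψ') (dψ.mul dφ') _).trans
      (congrArg₂ (· + ·) (dirDeriv_mul dφ dψ' _) (dirDeriv_mul dψ dφ' _))
  rw [h2, hφ.eq₀, hφ.eq₁, hφ.eq₂, hψ.eq₀, hψ.eq₁, hψ.eq₂]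
  ring

theorem HasHorJet.sub (hφ : F.HasHorJet t p φ a₀ a₁ a₂) (hψ : F.HasHorJet t p ψ b₀ b₁ b₂) :
    F.HasHorJet t p (fun q => φ q - ψ q) (a₀ - b₀) (a₁ - b₁) (a₂ - b₂) := by
  have h := hφ.add ((F.hasHorJet_const t p (-1)).mul hψ)
  have e : (fun q => φ q - ψ q) = fun q => φ q + -1 * ψ q := by
    ext q
    ring
  rw [e]
  convert! h using 1 <;> ring

variable (F)

/-- The first two horizontal derivatives of the square norm of the bracket, in an adapted
orthonormal basis. -/
theorem horDeriv_bracketNormSqAt (hnil : IsNilpotentLieGroup 𝒢)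
    (b : Module.Basis (Fin 3) ℝ (GroupLieAlgebra (𝓡 3) 𝒢))
    (hb : ∀ i j, F.G t p (b i) (b j) = if i = j then 1 else 0) {c : ℝ}
    (h01 : adBracket (b 0) (b 1) = c • b 2)
    (h2 : ∀ x : GroupLieAlgebra (𝓡 3) 𝒢, adBracket x (b 2) = 0)
    {D : Fin 3 → Fin 3 → ℝ}
    (hD : ∀ i j, F.DG t p (coordField (B.proj p) (B.proj p)) (b i) (b j) = D i j) :
    F.horDeriv t p (F.bracketNormSqAt t) p = 2 * c ^ 2 * (D 2 2 - D 0 0 - D 1 1) ∧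
    F.horDeriv t p (F.horDeriv t p (F.bracketNormSqAt t)) p =
      2 * c ^ 2 * (F.D2G t p (b 2) (b 2) - F.D2G t p (b 0) (b 0) - F.D2G t p (b 1) (b 1)
        + (D 2 2 - D 0 0 - D 1 1) ^ 2 - D 2 2 ^ 2 + D 0 0 ^ 2 + D 1 1 ^ 2
        + 2 * (D 0 1 ^ 2 + D 0 2 ^ 2 + D 1 2 ^ 2)) := by
  have hs : ∀ i j, D i j = D j i := fun i j => by rw [← hD, ← hD, DG_symm]
  have hM : ∀ i j, F.HasHorJet t p (fun q => F.G t q (b i) (b j)) (if i = j then 1 else 0)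
      (D i j) (F.D2G t p (b i) (b j)) := fun i j => by
    have := F.hasHorJet_G t p (b i) (b j)
    rwa [hb, hD] at this
  have hf : F.HasHorJet t p (F.bracketNormSqAt t) _ _ _ :=
    ⟨F.contMDiff_bracketNormSqAt hnil t, rfl, rfl, rfl⟩
  -- The two-jets of both sides of `|[,]|² · det G = 2 c² G_22²` are compared, which avoids
  -- differentiating a quotient twice. As `det G = 1` at `p`, the orders `0`, `1`, `2` can be solved
  -- in turn for the jet of `|[,]|²`.
  have hdet := (((((((hM 0 0).mul (hM 1 1)).mul (hM 2 2)).sub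
    (((hM 0 0).mul (hM 1 2)).mul (hM 2 1))).sub
    (((hM 0 1).mul (hM 1 0)).mul (hM 2 2))).add (((hM 0 1).mul (hM 1 2)).mul (hM 2 0))).add
    (((hM 0 2).mul (hM 1 0)).mul (hM 2 1))).sub (((hM 0 2).mul (hM 1 1)).mul (hM 2 0))
  have hl := hf.mul hdet
  have hr := (F.hasHorJet_const t p (2 * c ^ 2)).mul ((hM 2 2).mul (hM 2 2))
  have he : (fun q => F.bracketNormSqAt t q * _) = _ := funext fun q =>
    F.bracketNormSqAt_mul_det t q b h01 h2
  simp only [Matrix.det_fin_three, Matrix.of_apply, sq (F.G _ _ _ _)] at he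
  rw [he] at hl
  have k0 := hl.eq₀.symm.trans hr.eq₀
  have k1 := hl.eq₁.symm.trans hr.eq₁
  have k2 := hl.eq₂.symm.trans hr.eq₂
  simp only [if_true, Fin.reduceEq, if_false, mul_one, mul_zero, zero_mul, one_mul, add_zero,
    zero_add, sub_zero] at k0 k1 k2
  rw [k0] at k1 k2
  have e1 : F.horDeriv t p (F.bracketNormSqAt t) p = 2 * c ^ 2 * (D 2 2 - D 0 0 - D 1 1) := by
    linear_combination k1
  refine ⟨e1, ?_⟩
  rw [e1] at k2
  rw [hs 1 0, hs 2 0, hs 2 1] at k2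
  linear_combination k2

/-- A function pulled back from `M` has the same derivative along a horizontal lift as the original
has along the base vector, so both coordinate derivatives can be computed on `P`. -/
theorem laplacian_bracketNormSq (hnil : IsNilpotentLieGroup 𝒢) (ht : t ∈ J) (p : P) :
    F.laplacian t (F.bracketNormSq t) (B.proj p) =
      (F.horDeriv t p (F.horDeriv t p (F.bracketNormSqAt t)) p -
        F.christoffel t (B.proj p) * F.horDeriv t p (F.bracketNormSqAt t) p) /
      F.g t (B.proj p) (coordField (B.proj p) (B.proj p)) (coordField (B.proj p) (B.proj p)) := by
  have hchain : ∀ (f : M → ℝ) (q : P), MDifferentiableAt 𝓘(ℝ, ℝ) 𝓘(ℝ, ℝ) f (B.proj q) →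
      F.horDeriv t p (fun q => f (B.proj q)) q =
        dirDeriv f (B.proj q) (coordField (B.proj p) (B.proj q)) := by
    intro f q hf
    have h := mfderiv_comp_apply_model (f := B.proj) (g := f) (x := q) rfl
      Filter.EventuallyEq.rfl hf (B.smooth_proj.mdifferentiableAt (by simp))
      (F.hor t q (coordField (B.proj p) (B.proj q)))
    have h' : F.horDeriv t p (fun q => f (B.proj q)) q = dirDeriv f (B.proj q)
      (B.dProj q (F.hor t q (coordField (B.proj p) (B.proj q)))) := h
    rw [h', (F.hor_spec t q _).1]
  have hfP : (fun q => F.bracketNormSq t (B.proj q)) = F.bracketNormSqAt t :=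
    funext fun q => F.bracketNormSq_proj ht q
  have h1 : ∀ q, dirDeriv (F.bracketNormSq t) (B.proj q) (coordField (B.proj p) (B.proj q)) =
      F.horDeriv t p (F.bracketNormSqAt t) q := by
    intro q
    rw [← hchain _ q ((F.contMDiff_bracketNormSq hnil ht).mdifferentiableAt (by simp)), hfP]
  -- The second use of the chain rule needs the first derivative to be differentiable on `M`; near
  -- `proj p` it is the horizontal derivative composed with a local section.
  have hd : MDifferentiableAt 𝓘(ℝ, ℝ) 𝓘(ℝ, ℝ)
      (fun m' => dirDeriv (F.bracketNormSq t) m' (coordField (B.proj p) m')) (B.proj p) := by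
    obtain ⟨s, s1, s2, s3⟩ := B.exists_section_through p
    have hL := F.contMDiffAt_horDeriv t p (F.contMDiff_bracketNormSqAt hnil t)
    have hc : ContMDiffAt 𝓘(ℝ, ℝ) 𝓘(ℝ, ℝ) ∞
        (F.horDeriv t p (F.bracketNormSqAt t) ∘ s) (B.proj p) :=
      ContMDiffAt.comp _ (by rwa [s2]) s1
    refine (hc.congr_of_eventuallyEq ?_).mdifferentiableAt (by simp)
    filter_upwards [s3] with u hu
    rw [Function.comp_apply, ← h1, hu]
  have h2 : dirDeriv (fun m' => dirDeriv (F.bracketNormSq t) m' (coordField (B.proj p) m'))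
      (B.proj p) (coordField (B.proj p) (B.proj p)) =
      F.horDeriv t p (F.horDeriv t p (F.bracketNormSqAt t)) p := by
    rw [← hchain _ p hd]
    simp only [h1]
  unfold laplacian
  rw [h1, h2]

end InvariantFamily

/-! ### Alternating three-forms, slot by slot. -/

section Alternating

variable {V : Type*} [AddCommGroup V] [Module ℝ V] [TopologicalSpace V]

theorem ContinuousAlternatingMap.isLinearMap_zero (α : V [⋀^Fin 3]→L[ℝ] ℝ) (y z : V) :
    IsLinearMap ℝ (fun x => α ![x, y, z]) := by
  have h : ∀ x, ![x, y, z] = Function.update ![0, y, z] 0 x := fun x => by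
    ext i; fin_cases i <;> simp
  exact ⟨fun u u' => by simpa only [← h] using α.map_update_add ![0, y, z] 0 u u',
    fun c u => by simpa only [← h] using α.map_update_smul ![0, y, z] 0 c u⟩

theorem ContinuousAlternatingMap.isLinearMap_one (α : V [⋀^Fin 3]→L[ℝ] ℝ) (x z : V) :
    IsLinearMap ℝ (fun y => α ![x, y, z]) := by
  have h : ∀ y, ![x, y, z] = Function.update ![x, 0, z] 1 y := fun y => by
    ext i; fin_cases i <;> simp
  exact ⟨fun u u' => by simpa only [← h] using α.map_update_add ![x, 0, z] 1 u u',
    fun c u => by simpa only [← h] using α.map_update_smul ![x, 0, z] 1 c u⟩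

theorem ContinuousAlternatingMap.isLinearMap_two (α : V [⋀^Fin 3]→L[ℝ] ℝ) (x y : V) :
    IsLinearMap ℝ (fun z => α ![x, y, z]) := by
  have h : ∀ z, ![x, y, z] = Function.update ![x, y, 0] 2 z := fun z => by
    ext i; fin_cases i <;> simp
  exact ⟨fun u u' => by simpa only [← h] using α.map_update_add ![x, y, 0] 2 u u',
    fun c u => by simpa only [← h] using α.map_update_smul ![x, y, 0] 2 c u⟩

theorem ContinuousAlternatingMap.swap_left (α : V [⋀^Fin 3]→L[ℝ] ℝ) (x y z : V) :
    α ![y, x, z] = -α ![x, y, z] := by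
  have h := α.toAlternatingMap.map_swap ![x, y, z] (i := 0) (j := 1) (by decide)
  have e : ![x, y, z] ∘ Equiv.swap (0 : Fin 3) 1 = ![y, x, z] := by
    ext i; fin_cases i <;> rfl
  rw [e] at h
  exact h

theorem ContinuousAlternatingMap.swap_right (α : V [⋀^Fin 3]→L[ℝ] ℝ) (x y z : V) :
    α ![x, z, y] = -α ![x, y, z] := by
  have h := α.toAlternatingMap.map_swap ![x, y, z] (i := 1) (j := 2) (by decide)
  have e : ![x, y, z] ∘ Equiv.swap (1 : Fin 3) 2 = ![x, z, y] := by
    ext i; fin_cases i <;> rfl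
  rw [e] at h
  exact h

end Alternating

/-! ### The tensors of the flow in an orthonormal frame. -/

namespace InvariantFamily

variable {𝒢 P M : Type*}
  [TopologicalSpace 𝒢] [ChartedSpace (EuclideanSpace ℝ (Fin 3)) 𝒢] [Group 𝒢]
  [TopologicalSpace P] [ChartedSpace (EuclideanSpace ℝ (Fin 4)) P]
  [TopologicalSpace M] [ChartedSpace ℝ M]
  [IsManifold (𝓡 4) ∞ P] {B : PrincipalBundle 𝒢 P M} {J : Set ℝ} (F : InvariantFamily B J)
  (t : ℝ) (p : P)

theorem isLinearMap_Hmix_left (v : TangentSpace 𝓘(ℝ, ℝ) (B.proj p))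
    (y : GroupLieAlgebra (𝓡 3) 𝒢) : IsLinearMap ℝ (fun x => F.Hmix t p v x y) :=
  ((F.form t p).isLinearMap_one _ _).comp' (B.isLinearMap_fund p)

theorem isLinearMap_Hmix_right (v : TangentSpace 𝓘(ℝ, ℝ) (B.proj p))
    (x : GroupLieAlgebra (𝓡 3) 𝒢) : IsLinearMap ℝ (fun y => F.Hmix t p v x y) :=
  ((F.form t p).isLinearMap_two _ _).comp' (B.isLinearMap_fund p)

theorem Hmix_swap (v : TangentSpace 𝓘(ℝ, ℝ) (B.proj p)) (x y : GroupLieAlgebra (𝓡 3) 𝒢) :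
    F.Hmix t p v y x = -F.Hmix t p v x y :=
  (F.form t p).swap_right _ _ _

theorem Hvert_swap_left (x y z : GroupLieAlgebra (𝓡 3) 𝒢) :
    F.Hvert t p y x z = -F.Hvert t p x y z :=
  (F.form t p).swap_left _ _ _

theorem Hvert_swap_right (x y z : GroupLieAlgebra (𝓡 3) 𝒢) :
    F.Hvert t p x z y = -F.Hvert t p x y z :=
  (F.form t p).swap_right _ _ _

variable [LieGroup (𝓡 3) ∞ 𝒢]

theorem isLinearMap_DG_left (v : TangentSpace 𝓘(ℝ, ℝ) (B.proj p))
    (y : GroupLieAlgebra (𝓡 3) 𝒢) : IsLinearMap ℝ (fun x => F.DG t p v x y) := by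
  have hd := fun x => (F.contMDiff_G t x y).mdifferentiableAt (x := p) (by simp)
  constructor
  · intro x x'
    simp only [DG, ((F.isInner_G t _).bilin.left y).map_add]
    exact dirDeriv_add (hd x) (hd x') _
  · intro c x
    simp only [DG, ((F.isInner_G t _).bilin.left y).map_smul, smul_eq_mul]
    exact dirDeriv_const_mul c (hd x) _

theorem isLinearMap_DG_right (v : TangentSpace 𝓘(ℝ, ℝ) (B.proj p))
    (x : GroupLieAlgebra (𝓡 3) 𝒢) : IsLinearMap ℝ (fun y => F.DG t p v x y) := by
  simp only [F.DG_symm t p v x]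
  exact F.isLinearMap_DG_left t p v x

variable {t p}

theorem trG_orthonormal {b : Module.Basis (Fin 3) ℝ (GroupLieAlgebra (𝓡 3) 𝒢)}
    (hb : ∀ i j, F.G t p (b i) (b j) = if i = j then 1 else 0)
    {S : GroupLieAlgebra (𝓡 3) 𝒢 → GroupLieAlgebra (𝓡 3) 𝒢 → ℝ}
    (hS : IsBilin S) : F.trG t p S = ∑ i, S (b i) (b i) := by
  rw [F.trG_eq_traceIn_basis t p b hS, traceIn_orthonormal hb]

/-- `trG` is defined in the standard basis, and moving it to `b` requires a bilinear argument; for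
the outer trace this is bilinearity of the inner trace in the outer pair. -/
theorem trG_trG_orthonormal {b : Module.Basis (Fin 3) ℝ (GroupLieAlgebra (𝓡 3) 𝒢)}
    (hb : ∀ i j, F.G t p (b i) (b j) = if i = j then 1 else 0)
    {S : GroupLieAlgebra (𝓡 3) 𝒢 → GroupLieAlgebra (𝓡 3) 𝒢 →
      GroupLieAlgebra (𝓡 3) 𝒢 → GroupLieAlgebra (𝓡 3) 𝒢 → ℝ}
    (h1 : ∀ y y', IsBilin fun x x' => S x x' y y') (h2 : ∀ x x', IsBilin (S x x')) :
    F.trG t p (fun x x' => F.trG t p (S x x')) = ∑ i, ∑ j, S (b i) (b i) (b j) (b j) := by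
  rw [F.trG_orthonormal hb]
  · exact Finset.sum_congr rfl fun i _ => F.trG_orthonormal hb (h2 _ _)
  · simp only [trG_eq_traceIn]
    exact IsBilin.traceIn fun w w' => h1 w w'

theorem trG_trG_trG_orthonormal {b : Module.Basis (Fin 3) ℝ (GroupLieAlgebra (𝓡 3) 𝒢)}
    (hb : ∀ i j, F.G t p (b i) (b j) = if i = j then 1 else 0)
    {S : GroupLieAlgebra (𝓡 3) 𝒢 → GroupLieAlgebra (𝓡 3) 𝒢 →
      GroupLieAlgebra (𝓡 3) 𝒢 → GroupLieAlgebra (𝓡 3) 𝒢 →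
      GroupLieAlgebra (𝓡 3) 𝒢 → GroupLieAlgebra (𝓡 3) 𝒢 → ℝ}
    (h1 : ∀ y y' z z', IsBilin fun x x' => S x x' y y' z z')
    (h2 : ∀ x x' z z', IsBilin fun y y' => S x x' y y' z z')
    (h3 : ∀ x x' y y', IsBilin (S x x' y y')) :
    F.trG t p (fun x x' => F.trG t p fun y y' => F.trG t p (S x x' y y')) =
      ∑ i, ∑ j, ∑ k, S (b i) (b i) (b j) (b j) (b k) (b k) := by
  rw [F.trG_trG_orthonormal hb]
  · exact Finset.sum_congr rfl fun i _ => Finset.sum_congr rfl fun j _ =>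
      F.trG_orthonormal hb (h3 _ _ _ _)
  · intro y y'
    simp only [trG_eq_traceIn]
    exact IsBilin.traceIn fun w w' => h1 y y' w w'
  · intro x x'
    simp only [trG_eq_traceIn]
    exact IsBilin.traceIn fun w w' => h2 x x' w w'

theorem trG_trG_trG_trG_orthonormal {b : Module.Basis (Fin 3) ℝ (GroupLieAlgebra (𝓡 3) 𝒢)}
    (hb : ∀ i j, F.G t p (b i) (b j) = if i = j then 1 else 0)
    {S : GroupLieAlgebra (𝓡 3) 𝒢 → GroupLieAlgebra (𝓡 3) 𝒢 →
      GroupLieAlgebra (𝓡 3) 𝒢 → GroupLieAlgebra (𝓡 3) 𝒢 →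
      GroupLieAlgebra (𝓡 3) 𝒢 → GroupLieAlgebra (𝓡 3) 𝒢 →
      GroupLieAlgebra (𝓡 3) 𝒢 → GroupLieAlgebra (𝓡 3) 𝒢 → ℝ}
    (h1 : ∀ y y' z z' w w', IsBilin fun x x' => S x x' y y' z z' w w')
    (h2 : ∀ x x' z z' w w', IsBilin fun y y' => S x x' y y' z z' w w')
    (h3 : ∀ x x' y y' w w', IsBilin fun z z' => S x x' y y' z z' w w')
    (h4 : ∀ x x' y y' z z', IsBilin (S x x' y y' z z')) :
    F.trG t p (fun x x' => F.trG t p fun y y' => F.trG t p fun z z' =>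
        F.trG t p (S x x' y y' z z')) =
      ∑ i, ∑ j, ∑ k, ∑ l, S (b i) (b i) (b j) (b j) (b k) (b k) (b l) (b l) := by
  rw [F.trG_trG_trG_orthonormal hb]
  · exact Finset.sum_congr rfl fun i _ => Finset.sum_congr rfl fun j _ =>
      Finset.sum_congr rfl fun k _ => F.trG_orthonormal hb (h4 _ _ _ _ _ _)
  · intro y y' z z'
    simp only [trG_eq_traceIn]
    exact IsBilin.traceIn fun w w' => h1 y y' z z' w w'
  · intro x x' z z'
    simp only [trG_eq_traceIn]
    exact IsBilin.traceIn fun w w' => h2 x x' z z' w w'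
  · intro x x' y y'
    simp only [trG_eq_traceIn]
    exact IsBilin.traceIn fun w w' => h3 x x' y y' w w'

theorem T_orthonormal {b : Module.Basis (Fin 3) ℝ (GroupLieAlgebra (𝓡 3) 𝒢)}
    (hb : ∀ i j, F.G t p (b i) (b j) = if i = j then 1 else 0)
    (v : TangentSpace 𝓘(ℝ, ℝ) (B.proj p)) (x y z : GroupLieAlgebra (𝓡 3) 𝒢) :
    F.T t p v x y z = (∑ k, F.DG t p v (b k) x * F.G t p (adBracket y z) (b k))
      - (∑ k, F.DG t p v y (b k) * F.G t p (adBracket (b k) z) x)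
      + ∑ k, F.DG t p v z (b k) * F.G t p (adBracket (b k) y) x := by
  have hG := (F.isInner_G t p).bilin
  unfold T
  rw [F.trG_orthonormal hb, F.trG_orthonormal hb, F.trG_orthonormal hb]
  · exact IsBilin.mul (F.isLinearMap_DG_right t p v z)
      ((hG.left x).comp' (isLinearMap_adBracket_left y))
  · exact IsBilin.mul (F.isLinearMap_DG_right t p v y)
      ((hG.left x).comp' (isLinearMap_adBracket_left z))
  · exact IsBilin.mul (F.isLinearMap_DG_left t p v x) (hG.right _)

theorem trG_DG_DG {b : Module.Basis (Fin 3) ℝ (GroupLieAlgebra (𝓡 3) 𝒢)}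
    (hb : ∀ i j, F.G t p (b i) (b j) = if i = j then 1 else 0)
    (v : TangentSpace 𝓘(ℝ, ℝ) (B.proj p)) (x y : GroupLieAlgebra (𝓡 3) 𝒢) :
    F.trG t p (fun a a' => F.DG t p v x a * F.DG t p v a' y) =
      ∑ k, F.DG t p v x (b k) * F.DG t p v (b k) y :=
  F.trG_orthonormal hb (IsBilin.mul (F.isLinearMap_DG_right t p v x) (F.isLinearMap_DG_left t p v y))

theorem trG_bracket_bracket {b : Module.Basis (Fin 3) ℝ (GroupLieAlgebra (𝓡 3) 𝒢)}
    (hb : ∀ i j, F.G t p (b i) (b j) = if i = j then 1 else 0)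
    (x y : GroupLieAlgebra (𝓡 3) 𝒢) :
    F.trG t p (fun a a' => F.G t p (adBracket a x) (adBracket a' y)) =
      ∑ k, F.G t p (adBracket (b k) x) (adBracket (b k) y) :=
  F.trG_orthonormal hb (F.isBilin_G_adBracket t p x y)

theorem trG_trG_bracket {b : Module.Basis (Fin 3) ℝ (GroupLieAlgebra (𝓡 3) 𝒢)}
    (hb : ∀ i j, F.G t p (b i) (b j) = if i = j then 1 else 0)
    (x y : GroupLieAlgebra (𝓡 3) 𝒢) :
    F.trG t p (fun a a' => F.trG t p fun c c' =>
        F.G t p (adBracket a c) x * F.G t p (adBracket a' c') y) =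
      ∑ k, ∑ l, F.G t p (adBracket (b k) (b l)) x * F.G t p (adBracket (b k) (b l)) y := by
  have hG := (F.isInner_G t p).bilin
  exact F.trG_trG_orthonormal hb
    (fun _ _ => IsBilin.mul ((hG.left x).comp' (isLinearMap_adBracket_left _))
      ((hG.left y).comp' (isLinearMap_adBracket_left _)))
    (fun _ _ => IsBilin.mul ((hG.left x).comp' (isLinearMap_adBracket_right _))
      ((hG.left y).comp' (isLinearMap_adBracket_right _)))

theorem TNormSq_orthonormal {b : Module.Basis (Fin 3) ℝ (GroupLieAlgebra (𝓡 3) 𝒢)}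
    (hb : ∀ i j, F.G t p (b i) (b j) = if i = j then 1 else 0) : F.TNormSq t p =
    (∑ i, ∑ j, ∑ k, F.T t p (coordField (B.proj p) (B.proj p)) (b i) (b j) (b k) ^ 2) /
      F.g t (B.proj p) (coordField (B.proj p) (B.proj p)) (coordField (B.proj p) (B.proj p)) := by
  have hG := (F.isInner_G t p).bilin
  set v := coordField (B.proj p) (B.proj p)
  have l1 : ∀ y z, IsLinearMap ℝ (fun x => F.T t p v x y z) := fun y z => by
    simp only [F.T_orthonormal hb]
    exact ((IsLinearMap.sum' _ fun k => (F.isLinearMap_DG_right t p v _).mul_const' _).sub'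
      (IsLinearMap.sum' _ fun k => (hG.right _).const_mul' _)).add'
      (IsLinearMap.sum' _ fun k => (hG.right _).const_mul' _)
  have l2 : ∀ x z, IsLinearMap ℝ (fun y => F.T t p v x y z) := fun x z => by
    simp only [F.T_orthonormal hb]
    exact ((IsLinearMap.sum' _ fun k =>
        ((hG.left _).comp' (isLinearMap_adBracket_left _)).const_mul' _).sub'
      (IsLinearMap.sum' _ fun k => (F.isLinearMap_DG_left t p v _).mul_const' _)).add'
      (IsLinearMap.sum' _ fun k =>
        ((hG.left _).comp' (isLinearMap_adBracket_right _)).const_mul' _)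
  have l3 : ∀ x y, IsLinearMap ℝ (fun z => F.T t p v x y z) := fun x y => by
    simp only [F.T_orthonormal hb]
    exact ((IsLinearMap.sum' _ fun k =>
        ((hG.left _).comp' (isLinearMap_adBracket_right _)).const_mul' _).sub'
      (IsLinearMap.sum' _ fun k =>
        ((hG.left _).comp' (isLinearMap_adBracket_right _)).const_mul' _)).add'
      (IsLinearMap.sum' _ fun k => (F.isLinearMap_DG_left t p v _).mul_const' _)
  unfold TNormSq trg
  have h := F.trG_trG_trG_orthonormal hb
    (S := fun a a' b b' c c' => F.T t p v a b c * F.T t p v a' b' c')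
    (fun _ _ _ _ => IsBilin.mul (l1 _ _) (l1 _ _))
    (fun _ _ _ _ => IsBilin.mul (l2 _ _) (l2 _ _))
    (fun _ _ _ _ => IsBilin.mul (l3 _ _) (l3 _ _))
  simp only [← sq] at h
  exact congrArg (· / _) h

theorem HbracketNormSq_orthonormal {b : Module.Basis (Fin 3) ℝ (GroupLieAlgebra (𝓡 3) 𝒢)}
    (hb : ∀ i j, F.G t p (b i) (b j) = if i = j then 1 else 0) : F.HbracketNormSq t p =
    (∑ i, ∑ j, ∑ k, ∑ l, F.Hmix t p (coordField (B.proj p) (B.proj p)) (b i) (b j) *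
        F.Hmix t p (coordField (B.proj p) (B.proj p)) (b k) (b l) *
        F.G t p (adBracket (b i) (b j)) (adBracket (b k) (b l))) /
      F.g t (B.proj p) (coordField (B.proj p) (B.proj p)) (coordField (B.proj p) (B.proj p)) := by
  have hG := (F.isInner_G t p).bilin
  set v := coordField (B.proj p) (B.proj p)
  unfold HbracketNormSq trg
  refine congrArg (· / _) (F.trG_trG_trG_trG_orthonormal hb
    (S := fun a a' b b' c c' d d' =>
      F.Hmix t p v a b * F.Hmix t p v c d * F.G t p (adBracket a' b') (adBracket c' d'))
    (fun _ _ _ _ _ _ => IsBilin.mul ((F.isLinearMap_Hmix_left t p v _).mul_const' _)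
      ((hG.left _).comp' (isLinearMap_adBracket_left _)))
    (fun _ _ _ _ _ _ => IsBilin.mul ((F.isLinearMap_Hmix_right t p v _).mul_const' _)
      ((hG.left _).comp' (isLinearMap_adBracket_right _)))
    (fun _ _ _ _ _ _ => IsBilin.mul ((F.isLinearMap_Hmix_left t p v _).const_mul' _)
      ((hG.right _).comp' (isLinearMap_adBracket_left _)))
    (fun _ _ _ _ _ _ => IsBilin.mul ((F.isLinearMap_Hmix_right t p v _).const_mul' _)
      ((hG.right _).comp' (isLinearMap_adBracket_right _))))

theorem HvertNormSq_orthonormal {b : Module.Basis (Fin 3) ℝ (GroupLieAlgebra (𝓡 3) 𝒢)}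
    (hb : ∀ i j, F.G t p (b i) (b j) = if i = j then 1 else 0) : F.HvertNormSq t p =
    ∑ i, ∑ j, ∑ k, F.Hvert t p (b i) (b j) (b k) ^ 2 := by
  have l1 : ∀ y z, IsLinearMap ℝ (fun x => F.Hvert t p x y z) := fun y z =>
    ((F.form t p).isLinearMap_zero _ _).comp' (B.isLinearMap_fund p)
  have l2 : ∀ x z, IsLinearMap ℝ (fun y => F.Hvert t p x y z) := fun x z =>
    ((F.form t p).isLinearMap_one _ _).comp' (B.isLinearMap_fund p)
  have l3 : ∀ x y, IsLinearMap ℝ (fun z => F.Hvert t p x y z) := fun x y =>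
    ((F.form t p).isLinearMap_two _ _).comp' (B.isLinearMap_fund p)
  unfold HvertNormSq
  have h := F.trG_trG_trG_orthonormal hb
    (S := fun a a' b b' c c' => F.Hvert t p a b c * F.Hvert t p a' b' c')
    (fun _ _ _ _ => IsBilin.mul (l1 _ _) (l1 _ _))
    (fun _ _ _ _ => IsBilin.mul (l2 _ _) (l2 _ _))
    (fun _ _ _ _ => IsBilin.mul (l3 _ _) (l3 _ _))
  simp only [← sq] at h
  exact h

/-- `H²` on a vertical vector, in an orthonormal frame made up of vertical vectors and of a
multiple of the horizontal vector `h = hor v`. -/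
theorem Hsq_fund_orthonormal {b : Module.Basis (Fin 3) ℝ (GroupLieAlgebra (𝓡 3) 𝒢)}
    (hb : ∀ i j, F.G t p (b i) (b j) = if i = j then 1 else 0)
    {v : TangentSpace 𝓘(ℝ, ℝ) (B.proj p)} (hv : v ≠ 0)
    (x : GroupLieAlgebra (𝓡 3) 𝒢) :
    F.Hsq t p (B.fund p x) (B.fund p x) =
      (∑ j, ∑ k, F.Hvert t p x (b j) (b k) ^ 2) +
      2 * (∑ j, F.Hmix t p v x (b j) ^ 2) /
        (F.metric t).inner p (F.hor t p v) (F.hor t p v) := by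
  obtain ⟨k1, k2⟩ := F.hor_spec t p v
  have hI := F.isInner_metric t p
  have hne : F.hor t p v ≠ 0 := fun h => hv (by
    rw [← k1, h]
    exact (B.isLinearMap_dProj p).map_zero)
  set N := (F.metric t).inner p (F.hor t p v) (F.hor t p v) with hN
  have hpos : 0 < N := hI.pos _ hne
  have hr : (√N)⁻¹ * (√N)⁻¹ = N⁻¹ := by
    rw [← mul_inv, Real.mul_self_sqrt hpos.le]
  -- An orthonormal frame of the whole tangent space: `hor v` normalized, followed by the vertical
  -- vectors of `b`.
  let w : Fin 4 → TangentSpace (𝓡 4) p :=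
    Fin.cons ((√N)⁻¹ • F.hor t p v) fun i => B.fund p (b i)
  have hw : ∀ i j, (fun x y => (F.metric t).inner p x y) (w i) (w j) = if i = j then 1 else 0 := by
    intro i j
    refine Fin.cases ?_ (fun i => ?_) i <;> refine Fin.cases ?_ (fun j => ?_) j
    · simp only [w, Fin.cons_zero, map_smul, smul_apply, smul_eq_mul, ← hN, if_true]
      rw [← mul_assoc, hr, inv_mul_cancel₀ hpos.ne']
    · simp [w, k2, (Fin.succ_ne_zero j).symm]
    · simp only [w, Fin.cons_zero, Fin.cons_succ, Fin.succ_ne_zero, if_false]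
      rw [(F.metric t).symm]
      simp [k2]
    · simp only [w, Fin.cons_succ, Fin.succ_inj]
      exact hb i j
  have hli := linearIndependent_of_orthonormal hI.bilin hw
  have e4 : Module.finrank ℝ (TangentSpace (𝓡 4) p) = 4 := finrank_euclideanSpace_fin (𝕜 := ℝ)
  let W := basisOfLinearIndependentOfCardEqFinrank hli (by rw [e4]; rfl)
  have hW : ⇑W = w := coe_basisOfLinearIndependentOfCardEqFinrank hli _
  let E : Module.Basis (Fin 4) ℝ (TangentSpace (𝓡 4) p) :=
    (EuclideanSpace.basisFun (Fin 4) ℝ).toBasis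
  have hE : ⇑E = tangentBasis p := by
    ext1 i
    exact (EuclideanSpace.basisFun (Fin 4) ℝ).coe_toBasis ▸ EuclideanSpace.basisFun_apply _ _ i
  let g : TangentSpace (𝓡 4) p → TangentSpace (𝓡 4) p → ℝ := fun x y => (F.metric t).inner p x y
  have hform : ∀ Z : TangentSpace (𝓡 4) p, F.Hsq t p Z Z =
      ∑ i, ∑ j, F.form t p ![Z, w i, w j] ^ 2 := by
    intro Z
    have l1 := fun z => (F.form t p).isLinearMap_one Z z
    have l2 := fun z => (F.form t p).isLinearMap_two Z z
    have h1 : F.Hsq t p Z Z = traceIn E g fun a a' => traceIn E g fun c c' =>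
        F.form t p ![Z, a, c] * F.form t p ![Z, a', c'] := by
      simp only [Hsq, traceIn, Finset.mul_sum, hE, g, mul_assoc]
    have h2 : (fun a a' => traceIn E g fun c c' =>
        F.form t p ![Z, a, c] * F.form t p ![Z, a', c']) = fun a a' =>
          ∑ j, F.form t p ![Z, a, w j] * F.form t p ![Z, a', w j] := by
      ext a a'
      rw [traceIn_eq_of_bases E W hI.bilin (IsBilin.mul (l2 a) (l2 a')), hW,
        traceIn_orthonormal hw]
    rw [h1, h2, traceIn_eq_of_bases E W hI.bilin, hW, traceIn_orthonormal hw]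
    · simp only [sq]
    · exact ⟨fun _ => IsLinearMap.sum' _ fun _ => (l1 _).mul_const' _,
        fun _ => IsLinearMap.sum' _ fun _ => (l1 _).const_mul' _⟩
  have s0 : ∀ y z, F.form t p ![B.fund p x, y, (√N)⁻¹ • z] =
      (√N)⁻¹ * F.form t p ![B.fund p x, y, z] := fun y z =>
    ((F.form t p).isLinearMap_two _ _).map_smul _ _
  have s1 : ∀ y z, F.form t p ![B.fund p x, (√N)⁻¹ • y, z] =
      (√N)⁻¹ * F.form t p ![B.fund p x, y, z] := fun y z =>
    ((F.form t p).isLinearMap_one _ _).map_smul _ _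
  have s2 : F.form t p ![B.fund p x, F.hor t p v, F.hor t p v] = 0 :=
    (F.form t p).toAlternatingMap.map_eq_zero_of_eq _ (i := 1) (j := 2) rfl (by decide)
  have s3 : ∀ j, F.form t p ![B.fund p x, F.hor t p v, B.fund p (b j)] = -F.Hmix t p v x (b j) :=
    fun j => (F.form t p).swap_left _ _ _
  have s4 : ∀ j, F.form t p ![B.fund p x, B.fund p (b j), F.hor t p v] = F.Hmix t p v x (b j) :=
    fun j => by rw [(F.form t p).swap_right, s3, neg_neg]
  -- In the sum over both free slots two horizontal entries give zero, and one horizontal entry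
  -- gives the same square in either slot; hence the factor `2`.
  rw [hform]
  simp only [Fin.sum_univ_succ (n := 3), w, Fin.cons_zero, Fin.cons_succ, s0, s1, s2, s3, s4]
  have hv3 : ∀ j k, F.form t p ![B.fund p x, B.fund p (b j), B.fund p (b k)] =
      F.Hvert t p x (b j) (b k) := fun _ _ => rfl
  simp only [hv3, Finset.sum_add_distrib, mul_pow, neg_sq, ← Finset.mul_sum, mul_zero]
  rw [inv_pow, Real.sq_sqrt hpos.le]
  ring

end InvariantFamily

/-! ### The evolution equation. -/

namespace InvariantFamily

variable {𝒢 P M : Type*}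
  [TopologicalSpace 𝒢] [ChartedSpace (EuclideanSpace ℝ (Fin 3)) 𝒢] [Group 𝒢]
  [TopologicalSpace P] [ChartedSpace (EuclideanSpace ℝ (Fin 4)) P]
  [TopologicalSpace M] [ChartedSpace ℝ M]
  [IsManifold (𝓡 4) ∞ P] {B : PrincipalBundle 𝒢 P M} {J : Set ℝ} (F : InvariantFamily B J)

/-- `g` is defined at the representative `pt`, so at that point it is the metric on horizontal
lifts. Reading `v` as a real number removes its dependence on the point, so that the equality of
points can be substituted. -/
theorem g_eq_inner (t : ℝ) {p : P} (h : B.pt (B.proj p) = p)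
    (v : TangentSpace 𝓘(ℝ, ℝ) (B.proj p)) :
    F.g t (B.proj p) v v = (F.metric t).inner p (F.hor t p v) (F.hor t p v) := by
  have key : ∀ q, q = p → (F.metric t).inner q (F.hor t q (id v : ℝ)) (F.hor t q (id v : ℝ)) =
      (F.metric t).inner p (F.hor t p v) (F.hor t p v) := by
    rintro _ rfl
    rfl
  exact key _ h

variable [LieGroup (𝓡 3) ∞ 𝒢] [IsManifold 𝓘(ℝ, ℝ) ∞ M]

/-- The evolution equation of the square norm of the bracket. -/
theorem evolution_bracketNormSq (hnil : IsNilpotentLieGroup 𝒢) (hF : F.SolvesFlow) {t : ℝ}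
    (ht : t ∈ J) {p : P} (hp : B.pt (B.proj p) = p) :
    HasDerivWithinAt (fun s => F.bracketNormSqAt s p)
      (F.laplacian t (F.bracketNormSq t) (B.proj p) - (3 / 2) * F.bracketNormSqAt t p ^ 2 -
        (F.TNormSq t p + F.HbracketNormSq t p
          + (1 / 6) * F.HvertNormSq t p * F.bracketNormSqAt t p)) J t ∧
    0 ≤ F.TNormSq t p + F.HbracketNormSq t p
      + (1 / 6) * F.HvertNormSq t p * F.bracketNormSqAt t p := by
  obtain ⟨b, hb, ⟨c, h01⟩, h2⟩ := hnil.exists_adapted_basis (F.isInner_G t p)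
  have hI := F.isInner_G t p
  set v := coordField (B.proj p) (B.proj p) with hv
  have hv0 : v ≠ 0 := coordField_self_ne_zero _
  set r := F.g t (B.proj p) v v with hr
  have hrN := F.g_eq_inner t hp v
  have hrpos : 0 < r := by
    rw [hr, hrN]
    refine (F.metric t).pos p _ fun h => hv0 ?_
    rw [← (F.hor_spec t p v).1, h]
    exact (B.isLinearMap_dProj p).map_zero
  have h2' : ∀ x : GroupLieAlgebra (𝓡 3) 𝒢, adBracket (b 2) x = 0 := fun x => by
    rw [adBracket_swap, h2, neg_zero]
  have h10 : adBracket (b 1) (b 0) = (-c) • b 2 := by rw [adBracket_swap, h01, neg_smul]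
  have z1 : ∀ x, F.G t p 0 x = 0 := fun x => (hI.bilin.left x).map_zero
  have z2 : ∀ x, F.G t p x 0 = 0 := fun x => (hI.bilin.right x).map_zero
  have s1 : ∀ (a : ℝ) x y, F.G t p (a • x) y = a * F.G t p x y := fun a x y =>
    (hI.bilin.left y).map_smul a x
  have s2 : ∀ (a : ℝ) x y, F.G t p x (a • y) = a * F.G t p x y := fun a x y =>
    (hI.bilin.right x).map_smul a y
  -- The components of `DG`, of the mixed part of `H` and of its vertical part become opaque arrays
  -- `D`, `A`, `C`, so that what remains is a polynomial identity in them.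
  obtain ⟨D, hD⟩ : ∃ D : Fin 3 → Fin 3 → ℝ, ∀ i j, F.DG t p v (b i) (b j) = D i j :=
    ⟨fun i j => F.DG t p v (b i) (b j), fun _ _ => rfl⟩
  have hDs : ∀ i j, D i j = D j i := fun i j => by rw [← hD, ← hD, DG_symm]
  obtain ⟨A, hA⟩ : ∃ A : Fin 3 → Fin 3 → ℝ, ∀ i j, F.Hmix t p v (b i) (b j) = A i j :=
    ⟨fun i j => F.Hmix t p v (b i) (b j), fun _ _ => rfl⟩
  have hAs : ∀ i j, A j i = -A i j := fun i j => by rw [← hA, ← hA, Hmix_swap]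
  have hA0 : ∀ i, A i i = 0 := fun i => by linarith [hAs i i]
  obtain ⟨C, hC⟩ : ∃ C : Fin 3 → Fin 3 → Fin 3 → ℝ,
      ∀ i j k, F.Hvert t p (b i) (b j) (b k) = C i j k :=
    ⟨fun i j k => F.Hvert t p (b i) (b j) (b k), fun _ _ _ => rfl⟩
  have hCl : ∀ i j k, C j i k = -C i j k := fun i j k => by rw [← hC, ← hC, Hvert_swap_left]
  have hCr : ∀ i j k, C i k j = -C i j k := fun i j k => by rw [← hC, ← hC, Hvert_swap_right]
  have hC1 : ∀ i k, C i i k = 0 := fun i k => by linarith [hCl i i k]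
  have hC2 : ∀ i k, C i k k = 0 := fun i k => by linarith [hCr i k k]
  have hC3 : ∀ i k, C i k i = 0 := fun i k => by rw [hCr i i k, hC1, neg_zero]
  have hf : F.bracketNormSqAt t p = 2 * c ^ 2 := by
    have h := F.bracketNormSqAt_mul_det t p b h01 h2
    simpa [Matrix.det_fin_three, hb] using h
  -- Up to antisymmetry in the last two slots, the nonzero components of `T` are `c (D 2 2 - D 0 0 -
  -- D 1 1)`, `c D 0 2` and `c D 1 2`, the latter two occurring twice up to sign.
  have hT : F.TNormSq t p = 2 * c ^ 2 *
      (2 * D 0 2 ^ 2 + 2 * D 1 2 ^ 2 + (D 2 2 - D 0 0 - D 1 1) ^ 2) / r := by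
    rw [F.TNormSq_orthonormal hb]
    simp only [F.T_orthonormal hb, ← hv, hD, Fin.sum_univ_three, adBracket_self, h01, h10, h2, h2',
      z1, s1, hb, if_true, Fin.reduceEq, if_false, mul_one, mul_zero, add_zero, zero_add, sub_zero]
    rw [hDs 1 0, hDs 2 0, hDs 2 1, ← hr]
    ring
  have hHb : F.HbracketNormSq t p = 2 * c ^ 2 * (2 * A 0 1 ^ 2) / r := by
    rw [F.HbracketNormSq_orthonormal hb]
    simp only [← hv, hA, Fin.sum_univ_three, adBracket_self, h01, h10, h2, h2',
      z1, z2, s1, s2, hb, if_true, mul_one, mul_zero, add_zero, zero_add]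
    rw [hAs 0 1, ← hr]
    ring
  have hHv : F.HvertNormSq t p = 6 * C 0 1 2 ^ 2 := by
    rw [F.HvertNormSq_orthonormal hb]
    simp only [hC, Fin.sum_univ_three, hC1, hC2, hC3]
    rw [hCl 0 2 1, hCl 1 2 0, hCr 0 1 2, hCr 1 0 2, hCl 0 1 2]
    ring
  have hHsq : ∀ i, F.Hsq t p (B.fund p (b i)) (B.fund p (b i)) =
      (∑ j, ∑ k, C i j k ^ 2) + 2 * (∑ j, A i j ^ 2) / r := fun i => by
    rw [F.Hsq_fund_orthonormal hb hv0, ← hrN]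
    simp only [hC, hA]
    rfl
  obtain ⟨V, hV⟩ : ∃ V : Fin 3 → Fin 3 → ℝ, ∀ i j,
      HasDerivWithinAt (fun s => F.G s p (b i) (b j)) (V i j) J t ∧
      V i j = F.trDDG t p (b i) (b j)
        - F.trg t (B.proj p) (fun v v' => F.trG t p fun a a' =>
            F.DG t p v (b i) a * F.DG t p v' a' (b j))
        + F.trG t p (fun a a' => F.G t p (adBracket a (b i)) (adBracket a' (b j)))
        - (1 / 2) * F.trG t p (fun a a' => F.trG t p fun d d' =>
            F.G t p (adBracket a d) (b i) * F.G t p (adBracket a' d') (b j))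
        + (1 / 2) * F.Hsq t p (B.fund p (b i)) (B.fund p (b j)) :=
    ⟨_, fun i j => ⟨hF.eq_G t ht p (b i) (b j), rfl⟩⟩
  have hVi : ∀ i, V i i = (F.D2G t p (b i) (b i) - F.christoffel t (B.proj p) * D i i) / r
      - (∑ k, D i k * D k i) / r + (∑ k, F.G t p (adBracket (b k) (b i)) (adBracket (b k) (b i)))
      - (1 / 2) * (∑ k, ∑ l, F.G t p (adBracket (b k) (b l)) (b i) *
          F.G t p (adBracket (b k) (b l)) (b i))
      + (1 / 2) * ((∑ j, ∑ k, C i j k ^ 2) + 2 * (∑ j, A i j ^ 2) / r) := fun i => by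
    have e1 := F.trG_DG_DG hb v (b i) (b i)
    simp only [hD] at e1
    have e2 : F.trDDG t p (b i) (b i) =
        (F.D2G t p (b i) (b i) - F.christoffel t (B.proj p) * D i i) / r := by
      rw [← hD]
      rfl
    rw [(hV i i).2, F.trG_bracket_bracket hb, F.trG_trG_bracket hb, hHsq, e2, trg, e1]
  have hjet := F.horDeriv_bracketNormSqAt hnil b hb h01 h2 hD
  have hlap := F.laplacian_bracketNormSq hnil ht p
  rw [hjet.1, hjet.2] at hlap
  refine ⟨?_, ?_⟩
  · convert! F.hasDerivWithinAt_bracketNormSqAt b hb h01 h2 fun i j => (hV i j).1 using 1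
    -- In `V 2 2 - V 0 0 - V 1 1` the bracket terms sum to `-3 c²`, the vertical part of `H` gives
    -- `-(C 0 1 2)²`, and in the mixed part `A 0 2` and `A 1 2` cancel, leaving `-2 (A 0 1)² / r`.
    -- The squares of `D`, together with those in the Laplacian, make up `|T|²`.
    rw [hlap, hVi, hVi, hVi, hT, hHb, hHv, hf]
    simp only [Fin.sum_univ_three, adBracket_self, h01, h10, h2, h2',
      z1, s1, s2, hb, if_true, Fin.reduceEq, if_false, mul_one, mul_zero, add_zero, zero_add,
      hA0, hC1, hC2, hC3]
    rw [hCl 0 2 1, hCl 1 2 0, hCr 0 1 2, hCr 1 0 2, hCl 0 1 2, hAs 0 1, hAs 0 2, hAs 1 2,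
      hDs 1 0, hDs 2 0, hDs 2 1]
    ring
  · rw [hT, hHb, hHv, hf]
    positivity

end InvariantFamily

theorem proposition3p2 {𝒢 P M : Type*}
    [TopologicalSpace 𝒢] [ChartedSpace (EuclideanSpace ℝ (Fin 3)) 𝒢] [Group 𝒢]
    [LieGroup (𝓡 3) ∞ 𝒢] [T2Space 𝒢] [SigmaCompactSpace 𝒢]
    [TopologicalSpace P] [ChartedSpace (EuclideanSpace ℝ (Fin 4)) P]
    [IsManifold (𝓡 4) ∞ P] [T2Space P] [SigmaCompactSpace P]
    [TopologicalSpace M] [ChartedSpace ℝ M]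
    [IsManifold 𝓘(ℝ, ℝ) ∞ M] [T2Space M] [SigmaCompactSpace M]
    (hnil : IsNilpotentLieGroup 𝒢) (B : PrincipalBundle 𝒢 P M)
    (J : Set ℝ) (hJ : J.OrdConnected) (hJ' : J.Nontrivial)
    (F : InvariantFamily B J) (hF : F.SolvesFlow) :
    ∀ t ∈ J, ContMDiff 𝓘(ℝ, ℝ) 𝓘(ℝ, ℝ) ∞ (F.bracketNormSq t) ∧
      ∀ m : M,
        HasDerivWithinAt (fun s => F.bracketNormSq s m)
          (F.laplacian t (F.bracketNormSq t) m - (3 / 2) * (F.bracketNormSq t m) ^ 2 - F.SA t m)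
          J t ∧
        0 ≤ F.SA t m := by
  intro t ht
  refine ⟨F.contMDiff_bracketNormSq hnil ht, fun m => ?_⟩
  -- The functions on `M` are defined by evaluation at `pt m`, so the statement on `P` at this point
  -- is already the one on `M`, at every time `s`.
  have h := F.evolution_bracketNormSq hnil hF ht (p := B.pt m) (by rw [B.proj_pt])
  rw [B.proj_pt m] at h
  exact h
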